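/- Let $\mathcal L_n(x)=\sum_{m=0}^n\binom nm\frac{(-x)^m}{m!}$ be the Laguerre polynomials. For a random variable $X$ on $\mathbb Z_+$ with mass function $p_X$, let $\mathcal T(X)$ be the random variable on $\mathbb C$ with density $\sum_{n\ge0} p_X[n]\,\frac{e^{-|r|^2}|r|^{2n}}{n!\,\pi}$, and for a law $\nu$ on $\mathbb C$ let $\mathcal T^{-1}(\nu)[n]=\frac1\pi\int_{\mathbb C}\Big(\int_{\mathbb C} e^{r s^*-r^*s}\,\nu(dr)\Big)\mathcal L_n(|s|^2)\,ds$. For $0\le\eta\le1$ and independent $X,Y$ on $\mathbb Z_+$, the beamsplitter sum $Z=X\boxplus_\eta Y$ has the mass function $p_Z=\mathcal T^{-1}$ of the law of $\sqrt\eta\,\mathcal T(X)+\sqrt{1-\eta}\,\mathcal T(Y)$, with $\mathcal T(X),\mathcal T(Y)$ independent. Write $(X)_{(m)}=X(X-1)\cdots(X-m+1)$ and $$H_X(t)=\sum_{m\ge0}t^m\,\frac{\mathbb E(X)_{(m)}}{m!},\qquad \widetilde H_X(t)=\sum_{m\ge0}\frac{t^m}{m!}\,\frac{\mathbb E(X)_{(m)}}{m!}.$$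 Then $p_Z$ is a probability mass function on $\mathbb Z_+$, and the following hold. 1. $\widetilde H_Z(t)=\widetilde H_X(\eta t)\,\widetilde H_Y((1-\eta)t)$. This holds (a) as an identity of formal power series whenever all moments of $X$ and $Y$ are finite (and then those of $Z$ are finite); (b) at every real $t$ for which the moments of $X,Y$ are finite and the two series on the right converge absolutely (and then the series on the left does too); (c) for every $t\le0$ and all $X,Y$, without any moment condition, when $\widetilde H_W(t)$ is read as the absolutely convergent series $\sum_n p_W[n]\,\mathcal L_n(-t)$, for $W=X,Y,Z$. 2. Let $D_X$ be the set of $s>\eta$ for which $H_X\big(\frac{\eta}{s-\eta}\big)$ is well defined (finite moments, absolutely convergent series), $D_Y$ the set of $s>1-\eta$ for which $H_Y\big(\frac{1-\eta}{s-(1-\eta)}\big)$ is, and $D_Z$ the set of $s>1$ for which $H_Z\big(\frac1{s-1}\big)$ is. Suppose that $D_X$ and $D_Y$ are non-empty. Then there are continuous functions $M_X^{(\eta)}$, $M_Y^{(1-\eta)}$ on $[0,\infty)$ with Laplace transforms $$\frac{1}{s-\eta}H_X\Big(\frac{\eta}{s-\eta}\Big)\ (s\in D_X),\qquad \frac{1}{s-(1-\eta)}H_Y\Big(\frac{1-\eta}{s-(1-\eta)}\Big)\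 (s\in D_Y);$$ moreover $s_X+s_Y\in D_Z$ for all $s_X\in D_X$, $s_Y\in D_Y$; and for any such functions and every $s\in D_Z$ the Laplace integral of $M_X^{(\eta)}M_Y^{(1-\eta)}$ at $s$ converges absolutely and $$\frac1{s-1}H_Z\Big(\frac1{s-1}\Big)=\int_0^\infty e^{-st}M_X^{(\eta)}(t)\,M_Y^{(1-\eta)}(t)\,dt .$$ -/

import Mathlib

open MeasureTheory ProbabilityTheory Set
open scoped Nat

noncomputable section

namespace Beamsplitter

/-- The mass function `p_X[n] = P(X = n)` of a random variable with values in `ℕ`. -/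
def massFun {Ω : Type*} [MeasurableSpace Ω] (μ : Measure Ω) (X : Ω → ℕ) (n : ℕ) : ℝ :=
  μ.real (X ⁻¹' {n})

/-- `p` is a probability mass function on `ℕ`. -/
def IsMassFun (p : ℕ → ℝ) : Prop :=
  (∀ n, 0 ≤ p n) ∧ HasSum p 1

/-- The Laguerre polynomial `L_n(x) = ∑_{m ≤ n} (n choose m) (-x)^m / m!`. -/
def laguerre (n : ℕ) (x : ℝ) : ℝ :=
  ∑ m ∈ Finset.range (n + 1), (n.choose m : ℝ) * (-x) ^ m / (m ! : ℝ)

/-- The density on `ℂ` of the continuous counterpart of a random variable with mass function `p`: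
`∑ n, p[n] e^{-|r|²} |r|^{2n} / (n! π)`. -/
def contDensity (p : ℕ → ℝ) (r : ℂ) : ℝ :=
  ∑' n : ℕ, p n * (Real.exp (-‖r‖ ^ 2) * ‖r‖ ^ (2 * n) / ((n ! : ℝ) * Real.pi))

/-- The map `𝒯`: the law on `ℂ` of the continuous counterpart. -/
def contLaw (p : ℕ → ℝ) : Measure ℂ :=
  volume.withDensity fun r => ENNReal.ofReal (contDensity p r)

/-- The map `𝒯⁻¹`, on a law `ν` on `ℂ`:
`n ↦ (1/π) ∫ (∫ exp (r s* - r* s) ν(dr)) L_n(|s|²) ds`. The integral over `r` is the inner one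
(the double integral does not converge absolutely). For `ν` symmetric about `0` the value is real,
so that taking the real part only changes the type. -/
def contLawInv (ν : Measure ℂ) (n : ℕ) : ℝ :=
  ((1 / (Real.pi : ℂ)) * ∫ s : ℂ,
    (∫ r : ℂ, Complex.exp (r * (starRingEnd ℂ) s - (starRingEnd ℂ) r * s) ∂ν) *
      (laguerre n (‖s‖ ^ 2) : ℂ)).re

/-- The law of `√η U + √(1-η) V` for independent `U`, `V` with laws `ν₁`, `ν₂` on `ℂ`. -/
def scaledSumLaw (η : ℝ) (ν₁ ν₂ : Measure ℂ) : Measure ℂ :=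
  (ν₁.prod ν₂).map fun z => (Real.sqrt η : ℂ) * z.1 + (Real.sqrt (1 - η) : ℂ) * z.2

/-- Beamsplitter addition, on mass functions: `𝒯⁻¹ (√η 𝒯(X) + √(1-η) 𝒯(Y))`. -/
def beamsplitterAdd (η : ℝ) (p q : ℕ → ℝ) : ℕ → ℝ :=
  contLawInv (scaledSumLaw η (contLaw p) (contLaw q))

/-- The falling moment `E X(X-1)⋯(X-m+1)`. -/
def fallingMoment (p : ℕ → ℝ) (m : ℕ) : ℝ :=
  ∑' n : ℕ, (n.descFactorial m : ℝ) * p n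

/-- All falling moments are finite. -/
def FiniteMoments (p : ℕ → ℝ) : Prop :=
  ∀ m : ℕ, Summable fun n : ℕ => (n.descFactorial m : ℝ) * p n

/-- The exponential generating function of `E (X)_(m) / m!`, as a formal power series. -/
def expGenSeries (p : ℕ → ℝ) : PowerSeries ℝ :=
  PowerSeries.mk fun m => fallingMoment p m / (m ! : ℝ) / (m ! : ℝ)

/-- The exponential generating function `∑ m, t^m/m! (E (X)_(m) / m!)`, as a function. -/
def expGenFun (p : ℕ → ℝ) (t : ℝ) : ℝ :=
  ∑' m : ℕ, t ^ m / (m ! : ℝ) * (fallingMoment p m / (m ! : ℝ))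

/-- The exponential generating function is well defined at `t`. -/
def ExpGenConverges (p : ℕ → ℝ) (t : ℝ) : Prop :=
  FiniteMoments p ∧ Summable fun m : ℕ => t ^ m / (m ! : ℝ) * (fallingMoment p m / (m ! : ℝ))

/-- The ordinary generating function `∑ m, t^m (E (X)_(m) / m!)`. -/
def ordGenFun (p : ℕ → ℝ) (t : ℝ) : ℝ :=
  ∑' m : ℕ, t ^ m * (fallingMoment p m / (m ! : ℝ))

/-- The ordinary generating function is well defined at `t`. -/
def OrdGenConverges (p : ℕ → ℝ) (t : ℝ) : Prop :=
  FiniteMoments p ∧ Summable fun m : ℕ => t ^ m * (fallingMoment p m / (m ! : ℝ))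

/-- The set of `s > c` for which `1/(s-c) H_X(c/(s-c))` is well defined. -/
def ordDomain (c : ℝ) (p : ℕ → ℝ) : Set ℝ :=
  {s | c < s ∧ OrdGenConverges p (c / (s - c))}

/-- The Laplace integral `∫_0^∞ e^{-st} f(t) dt` converges absolutely, with value `v`. -/
def HasLaplace (f : ℝ → ℝ) (s v : ℝ) : Prop :=
  IntegrableOn (fun t => Real.exp (-(s * t)) * f t) (Ioi 0) ∧
    ∫ t in Ioi 0, Real.exp (-(s * t)) * f t = v

/-- `f` is the inverse Laplace transform of `F` (given on `D`): it is continuous on `[0, ∞)` and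
has the Laplace transform `F` on `D`. -/
def IsInverseLaplace (D : Set ℝ) (F f : ℝ → ℝ) : Prop :=
  ContinuousOn f (Ici 0) ∧ ∀ s ∈ D, HasLaplace f s (F s)

end Beamsplitter

end

open Beamsplitter

/-!
The map `𝒯` and its inverse turn mass functions into Laguerre expansions: the characteristic
function of `𝒯(X)` at `s` is `e^{-|s|²} ∑ p_X[n] L_n(|s|²)` (`hasSum_integral_contLaw`), which
follows from the Fourier transform of a Gaussian by differentiating in its width, and `𝒯⁻¹` reads the
coefficients of such an expansion off by orthogonality (`integral_tsum_mul_laguerre`). The outer integral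
converges because of the bound `|L_n(x)| ≤ e^{x/2}` (`abs_laguerre_le`), which expresses that
displacements are unitary.

Scaled independent sums multiply characteristic functions, so the beamsplitter sum is governed by
the products `L_j(η x) L_k((1-η) x)`. Each is a *non-negative* combination of the `L_n(x)`
(`exists_laguerre_linearization`): in the Fock form on `ℝ[x, y]`, for which multiplication by a
variable is adjoint to differentiation, Laguerre polynomials are overlaps of shifted monomials, and
the reflection that concentrates both shifts in the first variable is an isometry, so that the
coefficients come out as multiples of squares. Summing over `j` and `k` shows that the beamsplitter
sum is a mixture of these coefficients (`beamsplitterAdd_eq`); it is therefore a mass function, and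
its Laguerre series is the product of the two given ones.

Comparing coefficients of `x^m` in the linearization formula gives the convolution formula for
`E (X)_(m) / (m!)²` (`expGenCoeff_outputMassFun`), hence the product formula for the exponential
generating functions. Finally `(s-c)⁻¹ H(c/(s-c))` is the Laplace transform of `e^{ct} H̃(ct)`,
term by term, and by Lerch's theorem this is the only continuous inverse transform. The product formula
for `H̃` then becomes the one for the inverse Laplace transforms.
-/

namespace Beamsplitter

/-! ### Laguerre polynomials: recurrence and orthogonality -/

lemma laguerre_apply_zero (n : ℕ) : laguerre n 0 = 1 := by
  rw [laguerre, Finset.sum_eq_single 0]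
  · simp
  · intro m _ hm
    simp [hm]
  · simp

lemma continuous_laguerre (n : ℕ) : Continuous (laguerre n) := by
  unfold laguerre
  fun_prop

/-- The three-term relation `(n + 1) L_{n+1} = (n + 1 - x) L_n + x L_n'`. -/
lemma exists_hasDerivAt_laguerre (n : ℕ) (x : ℝ) :
    ∃ d, HasDerivAt (laguerre n) d x ∧
      (n + 1 : ℝ) * laguerre (n + 1) x = (n + 1 - x) * laguerre n x + x * d := by
  refine ⟨∑ m ∈ Finset.range (n + 1), (n.choose m : ℝ) * (m * (-x) ^ (m - 1) * (-1)) / (m ! : ℝ),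
    ?_, ?_⟩
  · unfold laguerre
    refine HasDerivAt.fun_sum fun m _ => ?_
    exact (((hasDerivAt_id x).neg.pow m).const_mul _).div_const _
  · have h1 : x * ∑ m ∈ Finset.range (n + 1),
        (n.choose m : ℝ) * (m * (-x) ^ (m - 1) * (-1)) / (m ! : ℝ) =
        ∑ m ∈ Finset.range (n + 2), (m * n.choose m : ℝ) * (-x) ^ m / (m ! : ℝ) := by
      rw [Finset.sum_range_succ _ (n + 1), Finset.mul_sum]
      simp only [Nat.choose_succ_self, Nat.cast_zero, mul_zero, zero_mul, zero_div, add_zero]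
      refine Finset.sum_congr rfl fun m _ => ?_
      rcases m with _ | m
      · simp
      · simp only [Nat.add_sub_cancel, pow_succ]
        ring
    have h2 : laguerre n x = ∑ m ∈ Finset.range (n + 2),
        (n.choose m : ℝ) * (-x) ^ m / (m ! : ℝ) := by
      rw [Finset.sum_range_succ _ (n + 1)]
      simp [laguerre]
    have h3 : -x * laguerre n x = ∑ m ∈ Finset.range (n + 2),
        (((n + 1).choose m - n.choose m : ℝ) * m) * (-x) ^ m / (m ! : ℝ) := by
      rw [Finset.sum_range_succ', laguerre, Finset.mul_sum]
      simp only [CharP.cast_eq_zero, mul_zero, zero_mul, zero_div, add_zero]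
      refine Finset.sum_congr rfl fun m _ => ?_
      rw [Nat.choose_succ_succ', Nat.factorial_succ]
      push_cast
      have : (m ! : ℝ) ≠ 0 := by positivity
      field_simp
      ring
    rw [h1]
    have h4 : (n + 1 - x) * laguerre n x = (n + 1) * laguerre n x + -x * laguerre n x := by ring
    rw [h4, h3, h2, Finset.mul_sum, ← Finset.sum_add_distrib, ← Finset.sum_add_distrib, laguerre,
      Finset.mul_sum]
    refine Finset.sum_congr rfl fun m hm => ?_
    have hm' : m ≤ n + 1 := by simpa [Nat.lt_succ_iff] using hm
    have key : ((n + 1 : ℝ) - m) * (n + 1).choose m = (n + 1) * n.choose m := by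
      have := Nat.choose_mul_succ_eq n m
      have h5 : (n.choose m : ℝ) * (n + 1) = (n + 1).choose m * ((n + 1 - m : ℕ) : ℝ) := by
        exact_mod_cast this
      rw [Nat.cast_sub hm'] at h5
      push_cast at h5
      linarith
    have : (n + 1 : ℝ) * (n + 1).choose m =
        (n + 1) * n.choose m + ((n + 1).choose m - n.choose m : ℝ) * m + m * n.choose m := by
      linarith
    rw [← mul_div_assoc, ← mul_assoc, this]
    ring

/-- The Gaussian moments `∫ |s|^{2k} e^{-|s|²} ds = π k!` on the plane. -/
lemma integral_pow_mul_exp_neg_sq (k : ℕ) :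
    ∫ s : ℂ, ‖s‖ ^ (2 * k) * Real.exp (-‖s‖ ^ 2) = Real.pi * k ! := by
  have h := Complex.integral_rpow_mul_exp_neg_rpow (p := 2) (q := (2 * k : ℕ)) (by norm_num)
    (by have : (0 : ℝ) ≤ (2 * k : ℕ) := by positivity
        linarith)
  simp only [Real.rpow_natCast, Real.rpow_two] at h
  rw [h, show (((2 * k : ℕ) : ℝ) + 2) / 2 = k + 1 by push_cast; ring, Real.Gamma_nat_eq_factorial]
  ring

lemma integrable_pow_mul_exp_neg_mul_sq (k : ℕ) {b : ℝ} (hb : 0 < b) :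
    Integrable fun s : ℂ => ‖s‖ ^ (2 * k) * Real.exp (-b * ‖s‖ ^ 2) := by
  refine Integrable.of_integral_ne_zero ?_
  have h0 : (0 : ℝ) ≤ (2 * k : ℕ) := by positivity
  have h := Complex.integral_rpow_mul_exp_neg_mul_rpow (p := 2) (q := (2 * k : ℕ)) (by norm_num)
    (by linarith) hb
  simp only [Real.rpow_natCast, Real.rpow_two] at h
  rw [h]
  have := Real.Gamma_pos_of_pos (s := (((2 * k : ℕ) : ℝ) + 2) / 2) (by linarith)
  positivity

/-- Laguerre polynomials are integrable against Gaussians, as combinations of monomials. -/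
lemma integrable_laguerre_mul_exp (n : ℕ) {b : ℝ} (hb : 0 < b) :
    Integrable fun s : ℂ => laguerre n (‖s‖ ^ 2) * Real.exp (-b * ‖s‖ ^ 2) := by
  unfold laguerre
  simp only [Finset.sum_mul]
  refine integrable_finsetSum _ fun m _ => ?_
  convert! (integrable_pow_mul_exp_neg_mul_sq m hb).const_mul
    ((n.choose m : ℝ) * (-1) ^ m / (m ! : ℝ)) using 2 with s
  rw [neg_pow, ← pow_mul]
  ring

/-- The alternating binomial sum `∑ (-1)^i C(n,i) C(i+a,k) = (-1)^n C(a,k-n)`. -/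
lemma sum_neg_one_pow_mul_choose_mul_choose (n a k : ℕ) :
    ∑ i ∈ Finset.range (n + 1), (-1 : ℝ) ^ i * n.choose i * (i + a).choose k =
      if n ≤ k then (-1) ^ n * (a.choose (k - n) : ℝ) else 0 := by
  induction n generalizing k with
  | zero => simp
  | succ n ih =>
    have h : ∑ i ∈ Finset.range (n + 2), (-1 : ℝ) ^ i * (n + 1).choose i * (i + a).choose k =
        ∑ i ∈ Finset.range (n + 1), (-1 : ℝ) ^ i * n.choose i *
          ((i + a).choose k - (i + 1 + a).choose k) := by
      have h1 : ∑ i ∈ Finset.range (n + 1), (-1 : ℝ) ^ i * n.choose i * (i + a).choose k =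
          ∑ i ∈ Finset.range (n + 2), (-1 : ℝ) ^ i * n.choose i * (i + a).choose k := by
        rw [Finset.sum_range_succ _ (n + 1)]
        simp
      simp only [mul_sub, Finset.sum_sub_distrib]
      rw [h1, Finset.sum_range_succ', Finset.sum_range_succ' _ (n + 1)]
      simp only [Nat.choose_succ_succ' n, Nat.cast_add, pow_succ, mul_add, add_mul,
        Finset.sum_add_distrib]
      simp
      ring
    rw [h]
    rcases k with _ | k
    · simp
    · have h2 : ∀ i, ((i + a).choose (k + 1) - (i + 1 + a).choose (k + 1) : ℝ) =
          -((i + a).choose k) := by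
        intro i
        rw [show i + 1 + a = i + a + 1 by ring, Nat.choose_succ_succ']
        push_cast
        ring
      simp only [h2, mul_neg, Finset.sum_neg_distrib, ih]
      by_cases hk : n ≤ k
      · simp [hk, pow_succ]
      · simp [hk]

lemma integral_laguerre_mul_pow (m k : ℕ) :
    ∫ s : ℂ, laguerre m (‖s‖ ^ 2) * (‖s‖ ^ (2 * k) * Real.exp (-‖s‖ ^ 2)) =
      Real.pi * (k ! * (-1) ^ m * k.choose m) := by
  have hint : ∀ i, Integrable fun s : ℂ => ‖s‖ ^ (2 * i) * Real.exp (-‖s‖ ^ 2) := fun i => by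
    simpa using integrable_pow_mul_exp_neg_mul_sq i one_pos
  have h1 : ∀ s : ℂ, laguerre m (‖s‖ ^ 2) * (‖s‖ ^ (2 * k) * Real.exp (-‖s‖ ^ 2)) =
      ∑ i ∈ Finset.range (m + 1), ((m.choose i : ℝ) * (-1) ^ i / (i ! : ℝ)) *
        (‖s‖ ^ (2 * (i + k)) * Real.exp (-‖s‖ ^ 2)) := by
    intro s
    rw [laguerre, Finset.sum_mul]
    refine Finset.sum_congr rfl fun i _ => ?_
    rw [neg_pow, ← pow_mul, mul_add, pow_add]
    ring
  simp only [h1]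
  rw [integral_finsetSum _ fun i _ => (hint _).const_mul _]
  simp only [integral_const_mul, integral_pow_mul_exp_neg_sq]
  have h2 := sum_neg_one_pow_mul_choose_mul_choose m k k
  have h3 : (if m ≤ k then (-1) ^ m * (k.choose (k - m) : ℝ) else 0) = (-1) ^ m * k.choose m := by
    split_ifs with h
    · rw [Nat.choose_symm h]
    · rw [Nat.choose_eq_zero_of_lt (by omega)]
      simp
  rw [h3] at h2
  rw [mul_assoc, ← h2, Finset.mul_sum, Finset.mul_sum]
  refine Finset.sum_congr rfl fun i _ => ?_
  have h4 : ((i + k).choose k : ℝ) * (i ! * k !) = (i + k)! := by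
    have := Nat.add_choose_mul_factorial_mul_factorial i k
    rw [← mul_assoc]
    exact_mod_cast this
  rw [← h4]
  have : (i ! : ℝ) ≠ 0 := by positivity
  field_simp

/-- Orthogonality of the Laguerre polynomials, on the plane. -/
lemma integral_laguerre_mul_laguerre (m n : ℕ) :
    ∫ s : ℂ, laguerre m (‖s‖ ^ 2) * laguerre n (‖s‖ ^ 2) * Real.exp (-‖s‖ ^ 2) =
      if m = n then Real.pi else 0 := by
  wlog hmn : n ≤ m generalizing m n
  · rw [show (if m = n then Real.pi else 0) = if n = m then Real.pi else 0 by simp [eq_comm],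
      ← this n m (by omega)]
    simp only [mul_comm (laguerre n _)]
  have hint : ∀ k, Integrable fun s : ℂ =>
      laguerre m (‖s‖ ^ 2) * (‖s‖ ^ (2 * k) * Real.exp (-‖s‖ ^ 2)) := by
    intro k
    unfold laguerre
    simp only [Finset.sum_mul]
    refine integrable_finsetSum _ fun i _ => ?_
    convert! (integrable_pow_mul_exp_neg_mul_sq (i + k) one_pos).const_mul
      ((m.choose i : ℝ) * (-1) ^ i / (i ! : ℝ)) using 2 with s
    rw [neg_pow, ← pow_mul, mul_add, pow_add, neg_one_mul]
    ring
  have h1 : ∀ s : ℂ, laguerre m (‖s‖ ^ 2) * laguerre n (‖s‖ ^ 2) * Real.exp (-‖s‖ ^ 2) =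
      ∑ k ∈ Finset.range (n + 1), ((n.choose k : ℝ) * (-1) ^ k / (k ! : ℝ)) *
        (laguerre m (‖s‖ ^ 2) * (‖s‖ ^ (2 * k) * Real.exp (-‖s‖ ^ 2))) := by
    intro s
    rw [laguerre.eq_1 n, Finset.mul_sum, Finset.sum_mul]
    refine Finset.sum_congr rfl fun i _ => ?_
    rw [neg_pow, ← pow_mul]
    ring
  simp only [h1]
  rw [integral_finsetSum _ fun i _ => (hint _).const_mul _]
  simp only [integral_const_mul, integral_laguerre_mul_pow]
  rw [Finset.sum_range_succ, Finset.sum_eq_zero, zero_add]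
  · rcases hmn.lt_or_eq with h | rfl
    · rw [if_neg h.ne', Nat.choose_eq_zero_of_lt h]
      simp
    · have : (n ! : ℝ) ≠ 0 := by positivity
      have h2 : ((-1 : ℝ) ^ n) * (-1) ^ n = 1 := by rw [← mul_pow]; simp
      simp only [Nat.choose_self, Nat.cast_one, if_true]
      field_simp
      linear_combination h2
  · intro k hk
    rw [Nat.choose_eq_zero_of_lt (n := k) (k := m) (by simp at hk; omega)]
    simp

/-! ### The bound `|L_n(x)| ≤ e^{x/2}` -/

/-- The coefficient of `X^m` in `e^{zX} (X - z)^n`: up to normalization these are the amplitudes of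
a displaced number state. -/
noncomputable def displacedCoeff (z : ℝ) (n m : ℕ) : ℝ :=
  PowerSeries.coeff m
    (PowerSeries.rescale z (PowerSeries.exp ℝ) * (PowerSeries.X - PowerSeries.C z) ^ n)

lemma displacedCoeff_zero_left (z : ℝ) (m : ℕ) : displacedCoeff z 0 m = z ^ m / (m ! : ℝ) := by
  simp [displacedCoeff, PowerSeries.coeff_exp, div_eq_mul_inv]

lemma displacedCoeff_succ_zero (z : ℝ) (n : ℕ) :
    displacedCoeff z (n + 1) 0 = -z * displacedCoeff z n 0 := by
  simp [displacedCoeff, pow_succ]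
  ring

lemma displacedCoeff_succ_succ (z : ℝ) (n m : ℕ) :
    displacedCoeff z (n + 1) (m + 1) =
      displacedCoeff z n m - z * displacedCoeff z n (m + 1) := by
  simp only [displacedCoeff]
  rw [pow_succ, ← mul_assoc, mul_sub, map_sub, PowerSeries.coeff_succ_mul_X,
    mul_comm _ (PowerSeries.C z), PowerSeries.coeff_C_mul]

/-- The coefficientwise form of
`d/dX (e^{zX} (X-z)^n) = z e^{zX} (X-z)^n + n e^{zX} (X-z)^{n-1}`. -/
lemma succ_mul_displacedCoeff (z : ℝ) (n m : ℕ) :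
    (m + 1 : ℝ) * displacedCoeff z n (m + 1) =
      z * displacedCoeff z n m + n * displacedCoeff z (n - 1) m := by
  induction n generalizing m with
  | zero =>
    simp only [displacedCoeff_zero_left, Nat.factorial_succ]
    have : (m ! : ℝ) ≠ 0 := by positivity
    push_cast
    field_simp
    rw [pow_succ]
    ring
  | succ n ih =>
    rw [displacedCoeff_succ_succ, mul_sub, mul_left_comm, ih, Nat.add_sub_cancel]
    rcases m with _ | m
    · rw [displacedCoeff_succ_zero]
      rcases n with _ | n
      · simp
        ring
      · rw [Nat.add_sub_cancel, displacedCoeff_succ_zero]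
        push_cast
        ring
    · have h := ih m
      rw [displacedCoeff_succ_succ z n m]
      rcases n with _ | n
      · push_cast at h ⊢
        linear_combination h
      · rw [Nat.add_sub_cancel] at h ⊢
        have h2 := displacedCoeff_succ_succ z n m
        push_cast at h ⊢
        linear_combination h - (n + 1) * h2

lemma summable_displacedCoeff_sq (z : ℝ) (n : ℕ) {ρ : ℝ} (hρ : 0 ≤ ρ) :
    Summable fun m => ρ ^ m * (m ! * displacedCoeff z n m ^ 2) := by
  induction n generalizing ρ with
  | zero =>
    simp only [displacedCoeff_zero_left]
    convert! Real.summable_pow_div_factorial (ρ * z ^ 2) using 2 with m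
    have : (m ! : ℝ) ≠ 0 := by positivity
    field_simp
    ring
  | succ n ih =>
    rw [← summable_nat_add_iff 1]
    have h1 := (ih (ρ := 2 * ρ) (by positivity)).mul_left (2 * ρ)
    have h2 := ((summable_nat_add_iff 1).mpr (ih hρ)).mul_left (2 * z ^ 2)
    refine Summable.of_nonneg_of_le (fun m => by positivity) (fun m => ?_) (h1.add h2)
    rw [displacedCoeff_succ_succ]
    set a := displacedCoeff z n m
    set b := displacedCoeff z n (m + 1)
    have h3 : ((m : ℝ) + 1) ≤ 2 ^ m := by exact_mod_cast Nat.lt_two_pow_self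
    have h4 : (a - z * b) ^ 2 ≤ 2 * a ^ 2 + 2 * z ^ 2 * b ^ 2 := by
      nlinarith [sq_nonneg (a + z * b)]
    calc ρ ^ (m + 1) * ((m + 1)! * (a - z * b) ^ 2)
        ≤ ρ ^ (m + 1) * ((m + 1)! * (2 * a ^ 2 + 2 * z ^ 2 * b ^ 2)) := by gcongr
      _ = 2 * ρ * ((m + 1 : ℝ) * ρ ^ m * (m ! * a ^ 2)) +
          2 * z ^ 2 * (ρ ^ (m + 1) * ((m + 1)! * b ^ 2)) := by
        rw [Nat.factorial_succ]
        push_cast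
        ring
      _ ≤ 2 * ρ * (2 ^ m * ρ ^ m * (m ! * a ^ 2)) +
          2 * z ^ 2 * (ρ ^ (m + 1) * ((m + 1)! * b ^ 2)) := by gcongr
      _ = _ := by rw [mul_pow]

/-- The norm of a displaced number state: `∑ m! c_m² = n! e^{z²}`. -/
lemma hasSum_displacedCoeff_sq (z : ℝ) (n : ℕ) :
    HasSum (fun m => m ! * displacedCoeff z n m ^ 2) (n ! * Real.exp (z ^ 2)) := by
  have hs : ∀ n, Summable fun m => m ! * displacedCoeff z n m ^ 2 := fun n => by
    simpa using summable_displacedCoeff_sq z n zero_le_one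
  induction n with
  | zero =>
    simp only [displacedCoeff_zero_left, Nat.factorial_zero, Nat.cast_one, one_mul]
    convert! NormedSpace.expSeries_div_hasSum_exp (𝔸 := ℝ) (z ^ 2) using 1
    · ext m
      have : (m ! : ℝ) ≠ 0 := by positivity
      field_simp
      ring
    · rw [Real.exp_eq_exp_ℝ]
  | succ n ih =>
    -- cross terms are summable, by the inequality of arithmetic and geometric means
    have hc : Summable fun m => m ! * (displacedCoeff z (n + 1) m * displacedCoeff z n m) := by
      refine Summable.of_norm_bounded ((hs (n + 1)).add (hs n)) fun m => ?_
      rw [Real.norm_eq_abs, abs_mul, abs_of_nonneg (by positivity : (0 : ℝ) ≤ m !), ← mul_add]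
      gcongr
      rw [abs_le]
      constructor <;> nlinarith [sq_nonneg (displacedCoeff z (n + 1) m + displacedCoeff z n m),
        sq_nonneg (displacedCoeff z (n + 1) m - displacedCoeff z n m)]
    have h1 : HasSum (fun m => (m ! : ℝ) * (displacedCoeff z (n + 1) m *
        displacedCoeff z (n + 1) m) + z * (m ! * (displacedCoeff z (n + 1) m *
        displacedCoeff z n m)))
        (z * ∑' m, m ! * (displacedCoeff z (n + 1) m * displacedCoeff z n m) +
          (n + 1) * (n ! * Real.exp (z ^ 2))) := by
      rw [← hasSum_nat_add_iff' 1]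
      convert! (hc.hasSum.mul_left z).add (ih.mul_left (n + 1 : ℝ)) using 1
      · ext m
        have h2 := displacedCoeff_succ_succ z n m
        have h3 := succ_mul_displacedCoeff z (n + 1) m
        rw [Nat.add_sub_cancel] at h3
        rw [Nat.factorial_succ]
        push_cast at h3 ⊢
        linear_combination (m + 1 : ℝ) * m ! * displacedCoeff z (n + 1) (m + 1) * h2 +
          m ! * displacedCoeff z n m * h3
      · simp [displacedCoeff_succ_zero]
        ring
    have h2 := h1.sub (hc.hasSum.mul_left z)
    convert! h2 using 1
    · ext m
      ring
    · rw [Nat.factorial_succ]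
      push_cast
      ring

lemma displacedCoeff_self (z : ℝ) (n : ℕ) : displacedCoeff z n n = laguerre n (z ^ 2) := by
  rw [displacedCoeff, sub_eq_add_neg, add_pow, Finset.mul_sum, map_sum, laguerre,
    ← Finset.sum_range_reflect]
  refine Finset.sum_congr rfl fun i hi => ?_
  have hi' : i ≤ n := by simpa [Nat.lt_succ_iff] using hi
  have h : PowerSeries.rescale z (PowerSeries.exp ℝ) * (PowerSeries.X ^ (n + 1 - 1 - i) *
      (-PowerSeries.C z) ^ (n - (n + 1 - 1 - i)) * (n.choose (n + 1 - 1 - i) : PowerSeries ℝ)) =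
      PowerSeries.C ((-z) ^ i * n.choose i) * (PowerSeries.rescale z (PowerSeries.exp ℝ) *
        PowerSeries.X ^ (n - i)) := by
    rw [Nat.add_sub_cancel, Nat.sub_sub_self hi', Nat.choose_symm hi']
    simp only [map_mul, map_pow, map_neg, map_natCast]
    ring
  rw [h, PowerSeries.coeff_C_mul, PowerSeries.coeff_mul_X_pow', if_pos (Nat.sub_le _ _),
    Nat.sub_sub_self hi', PowerSeries.coeff_rescale, PowerSeries.coeff_exp]
  simp only [one_div, map_inv₀, map_natCast, neg_pow z, neg_pow (z ^ 2), ← pow_mul, two_mul,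
    pow_add]
  ring

/-- The classical bound `|L_n(x)| ≤ e^{x/2}`: up to a factor, `L_n(z²)` is the overlap of a number
state with its displacement, both of norm one. -/
lemma abs_laguerre_le (n : ℕ) {x : ℝ} (hx : 0 ≤ x) : |laguerre n x| ≤ Real.exp (x / 2) := by
  obtain ⟨z, rfl⟩ : ∃ z : ℝ, x = z ^ 2 := ⟨√x, (Real.sq_sqrt hx).symm⟩
  have h := le_hasSum (hasSum_displacedCoeff_sq z n) n fun m _ => by positivity
  rw [displacedCoeff_self] at h
  have h2 : laguerre n (z ^ 2) ^ 2 ≤ Real.exp (z ^ 2 / 2) ^ 2 := by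
    rw [← Real.exp_nat_mul]
    have : (0 : ℝ) < n ! := by positivity
    convert! le_of_mul_le_mul_left h this using 2
    push_cast
    ring
  exact abs_le_of_sq_le_sq h2 (by positivity)

/-! ### Linearization of products of Laguerre polynomials -/

open MvPolynomial in
/-- The Fock (or Fischer) form on `ℝ[x, y]`: monomials are orthogonal and
`⟨x^i y^l, x^i y^l⟩ = i! l!`. -/
noncomputable def fockForm :
    MvPolynomial (Fin 2) ℝ →ₗ[ℝ] MvPolynomial (Fin 2) ℝ →ₗ[ℝ] ℝ :=
  (basisMonomials (Fin 2) ℝ).constr ℝ fun d => ((d 0)! * (d 1)! : ℝ) • lcoeff ℝ d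

section FockForm
open MvPolynomial

lemma fockForm_monomial (d : Fin 2 →₀ ℕ) (g : MvPolynomial (Fin 2) ℝ) :
    fockForm (monomial d 1) g = (d 0)! * (d 1)! * coeff d g := by
  have h : (basisMonomials (Fin 2) ℝ) d = monomial d 1 := by simp
  rw [fockForm, ← h, Module.Basis.constr_basis]
  simp [lcoeff]

lemma fockForm_C (a : ℝ) (g : MvPolynomial (Fin 2) ℝ) :
    fockForm (C a) g = a * constantCoeff g := by
  have h : (C a : MvPolynomial (Fin 2) ℝ) = a • monomial 0 1 := by
    rw [smul_monomial, C_apply, smul_eq_mul, mul_one]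
  rw [h, map_smul, LinearMap.smul_apply, fockForm_monomial]
  simp [constantCoeff_eq]

/-- In the Fock form, multiplication by a variable is adjoint to the partial derivative. -/
lemma fockForm_mul_X (f g : MvPolynomial (Fin 2) ℝ) (i : Fin 2) :
    fockForm (f * X i) g = fockForm f (pderiv i g) := by
  induction f using MvPolynomial.induction_on' with
  | add p q hp hq => simp only [add_mul, map_add, LinearMap.add_apply, hp, hq]
  | monomial d a =>
    have h1 : monomial d a = a • monomial d (1 : ℝ) := by simp [smul_monomial]
    have h2 : monomial d a * X i = a • monomial (d + Finsupp.single i 1) (1 : ℝ) := by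
      simp [X, monomial_mul, smul_monomial]
    rw [h2, h1, map_smul, map_smul, LinearMap.smul_apply, LinearMap.smul_apply, fockForm_monomial,
      fockForm_monomial, coeff_pderiv]
    congr 1
    fin_cases i
    · simp [Nat.factorial_succ]
      ring
    · simp [Nat.factorial_succ]
      ring

/-- The substitution `x ↦ σ x + τ y`, `y ↦ τ x - σ y`: the action of a beamsplitter on creation
operators. It is a reflection when `σ² + τ² = 1`. -/
noncomputable def reflect (σ τ : ℝ) : MvPolynomial (Fin 2) ℝ →ₐ[ℝ] MvPolynomial (Fin 2) ℝ :=
  aeval ![C σ * X 0 + C τ * X 1, C τ * X 0 - C σ * X 1]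

lemma reflect_X_zero (σ τ : ℝ) : reflect σ τ (X 0) = C σ * X 0 + C τ * X 1 := by
  simp [reflect]

lemma reflect_X_one (σ τ : ℝ) : reflect σ τ (X 1) = C τ * X 0 - C σ * X 1 := by
  simp [reflect]

lemma constantCoeff_reflect (σ τ : ℝ) (g : MvPolynomial (Fin 2) ℝ) :
    constantCoeff (reflect σ τ g) = constantCoeff g := by
  induction g using MvPolynomial.induction_on with
  | C a => simp [reflect]
  | add p q hp hq => simp only [map_add, hp, hq]
  | mul_X p i hp =>
    rw [map_mul, map_mul, map_mul]
    fin_cases i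
    · simp [reflect_X_zero]
    · simp [reflect_X_one]

/-- The chain rule for the substitution `reflect`. -/
lemma pderiv_reflect {σ τ : ℝ} (h : σ ^ 2 + τ ^ 2 = 1) (g : MvPolynomial (Fin 2) ℝ) :
    C σ * pderiv 0 (reflect σ τ g) + C τ * pderiv 1 (reflect σ τ g) =
        reflect σ τ (pderiv 0 g) ∧
      C τ * pderiv 0 (reflect σ τ g) - C σ * pderiv 1 (reflect σ τ g) =
        reflect σ τ (pderiv 1 g) := by
  have hC : (C σ ^ 2 + C τ ^ 2 : MvPolynomial (Fin 2) ℝ) = 1 := by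
    rw [← C_pow, ← C_pow, ← C_add, h, C_1]
  induction g using MvPolynomial.induction_on with
  | C a => simp [reflect]
  | add p q hp hq =>
    simp only [map_add, ← hp.1, ← hq.1, ← hp.2, ← hq.2]
    constructor <;> ring
  | mul_X p i hp =>
    fin_cases i
    · simp only [Fin.zero_eta, Fin.isValue, map_mul, reflect_X_zero, Derivation.leibniz,
        smul_eq_mul, map_add, pderiv_C, pderiv_X_self, pderiv_X_of_ne (one_ne_zero (α := Fin 2)),
        pderiv_X_of_ne (zero_ne_one (α := Fin 2)), ← hp.1, ← hp.2]
      simp only [map_one, map_zero]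
      constructor
      · linear_combination (reflect σ τ p) * hC
      · ring
    · simp only [Fin.mk_one, Fin.isValue, map_mul, reflect_X_one, Derivation.leibniz, map_sub,
        smul_eq_mul, map_add, pderiv_C, pderiv_X_self, pderiv_X_of_ne (one_ne_zero (α := Fin 2)),
        pderiv_X_of_ne (zero_ne_one (α := Fin 2)), ← hp.1, ← hp.2]
      simp only [map_one, map_zero]
      constructor
      · ring
      · linear_combination (reflect σ τ p) * hC

/-- A beamsplitter acts by an isometry of the Fock form. -/
lemma fockForm_reflect {σ τ : ℝ} (h : σ ^ 2 + τ ^ 2 = 1) (f g : MvPolynomial (Fin 2) ℝ) :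
    fockForm (reflect σ τ f) (reflect σ τ g) = fockForm f g := by
  induction f using MvPolynomial.induction_on generalizing g with
  | C a =>
    have h1 : reflect σ τ (C a) = C a := by simp [reflect]
    rw [h1, fockForm_C, fockForm_C, constantCoeff_reflect]
  | add p q hp hq => simp only [map_add, LinearMap.add_apply, hp, hq]
  | mul_X p i hp =>
    have key (a : ℝ) (q : MvPolynomial (Fin 2) ℝ) (i : Fin 2) :
        fockForm (q * (C a * X i)) (reflect σ τ g) =
          fockForm q (C a * pderiv i (reflect σ τ g)) := by
      rw [C_mul', C_mul', mul_smul_comm, map_smul, map_smul, LinearMap.smul_apply, fockForm_mul_X]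
    rw [fockForm_mul_X, ← hp, map_mul]
    fin_cases i
    · simp only [Fin.zero_eta, Fin.isValue, reflect_X_zero]
      rw [← (pderiv_reflect h g).1, mul_add, map_add, map_add, LinearMap.add_apply, key, key]
    · simp only [Fin.mk_one, Fin.isValue, reflect_X_one]
      rw [← (pderiv_reflect h g).2, mul_sub, map_sub, map_sub, LinearMap.sub_apply, key, key]

/-- The one-variable Fock form of `(x + a)^n` and `(x + a')^n'`. -/
noncomputable def shiftedOverlap (n n' : ℕ) (a a' : ℝ) : ℝ :=
  ∑ i ∈ Finset.range (n + 1), ∑ i' ∈ Finset.range (n' + 1),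
    (n.choose i * a ^ (n - i)) * (n'.choose i' * a' ^ (n' - i')) * if i = i' then (i ! : ℝ) else 0

lemma shiftedOverlap_self (n : ℕ) (a a' : ℝ) :
    shiftedOverlap n n a a' = n ! * laguerre n (-(a * a')) := by
  rw [shiftedOverlap, laguerre, Finset.mul_sum, ← Finset.sum_range_reflect]
  refine Finset.sum_congr rfl fun i hi => ?_
  have hi' : i ≤ n := by simpa [Nat.lt_succ_iff] using hi
  simp only [mul_ite, mul_zero, Finset.sum_ite_eq]
  rw [if_pos (by simp), Nat.add_sub_cancel, Nat.sub_sub_self hi', Nat.choose_symm hi',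
    ← Nat.choose_mul_factorial_mul_factorial hi', neg_neg, mul_pow]
  have : (i ! : ℝ) ≠ 0 := by positivity
  push_cast
  field_simp

lemma shiftedOverlap_zero (n n' : ℕ) :
    shiftedOverlap n n' 0 0 = if n = n' then (n ! : ℝ) else 0 := by
  rw [shiftedOverlap, Finset.sum_range_succ, Finset.sum_eq_zero, zero_add, Finset.sum_range_succ,
    Finset.sum_eq_zero, zero_add]
  · simp
  · intro i hi
    rw [zero_pow (n := n' - i) (by simp at hi; omega)]
    simp
  · intro i hi
    rw [zero_pow (n := n - i) (by simp at hi; omega)]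
    simp

lemma fockForm_X_pow (i l i' l' : ℕ) :
    fockForm (X 0 ^ i * X 1 ^ l) (X 0 ^ i' * X 1 ^ l') =
      (if i = i' then (i ! : ℝ) else 0) * if l = l' then (l ! : ℝ) else 0 := by
  have h : ∀ i l, (X 0 ^ i * X 1 ^ l : MvPolynomial (Fin 2) ℝ) =
      monomial (Finsupp.single 0 i + Finsupp.single 1 l) 1 := by
    intro i l
    simp [X_pow_eq_monomial, monomial_mul]
  rw [h, h, fockForm_monomial, coeff_monomial]
  have h2 : (Finsupp.single (0 : Fin 2) i' + Finsupp.single 1 l' =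
      Finsupp.single 0 i + Finsupp.single 1 l) ↔ i = i' ∧ l = l' := by
    constructor
    · intro h
      have h0 := DFunLike.congr_fun h 0
      have h1 := DFunLike.congr_fun h 1
      simp at h0 h1
      exact ⟨h0.symm, h1.symm⟩
    · rintro ⟨rfl, rfl⟩
      rfl
  rw [if_congr h2 rfl rfl, ite_and]
  split_ifs <;> simp

lemma fockForm_shifted (n m n' m' : ℕ) (a b a' b' : ℝ) :
    fockForm ((X 0 + C a) ^ n * (X 1 + C b) ^ m) ((X 0 + C a') ^ n' * (X 1 + C b') ^ m') =
      shiftedOverlap n n' a a' * shiftedOverlap m m' b b' := by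
  have h : ∀ (n m : ℕ) (a b : ℝ),
      ((X 0 + C a) ^ n * (X 1 + C b) ^ m : MvPolynomial (Fin 2) ℝ) =
        ∑ i ∈ Finset.range (n + 1), ∑ l ∈ Finset.range (m + 1),
          ((n.choose i * a ^ (n - i)) * (m.choose l * b ^ (m - l))) • (X 0 ^ i * X 1 ^ l) := by
    intro n m a b
    rw [add_pow, add_pow, Finset.sum_mul_sum]
    refine Finset.sum_congr rfl fun i _ => Finset.sum_congr rfl fun l _ => ?_
    rw [← C_mul']
    simp only [map_mul, map_pow, map_natCast]
    ring
  rw [h, h, shiftedOverlap, shiftedOverlap]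
  simp only [map_sum, LinearMap.sum_apply, map_smul, LinearMap.smul_apply, fockForm_X_pow,
    smul_eq_mul]
  rw [Finset.sum_comm (s := Finset.range (n + 1)), Finset.sum_comm (s := Finset.range (m + 1)),
    Finset.sum_mul_sum]
  refine Finset.sum_congr rfl fun i _ => Finset.sum_congr rfl fun l _ => ?_
  rw [Finset.sum_mul_sum, Finset.mul_sum]
  refine Finset.sum_congr rfl fun i' _ => ?_
  rw [Finset.mul_sum]
  refine Finset.sum_congr rfl fun l' _ => ?_
  ring

/-- The product `L_j(σ² x) L_k(τ² x)` as a matrix element in the Fock form: reflecting the number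
state `x^j y^k` turns both displacements into displacements of the first variable alone. -/
lemma laguerre_mul_laguerre_eq_sum {σ τ : ℝ} (h : σ ^ 2 + τ ^ 2 = 1) (j k : ℕ) (x : ℝ) :
    (j ! * k ! : ℝ) * (laguerre j (σ ^ 2 * x) * laguerre k (τ ^ 2 * x)) =
      ∑ d ∈ (reflect σ τ (X 0 ^ j * X 1 ^ k)).support,
        coeff d (reflect σ τ (X 0 ^ j * X 1 ^ k)) ^ 2 * ((d 0)! * (d 1)!) *
          laguerre (d 0) x := by
  set q := reflect σ τ (X 0 ^ j * X 1 ^ k) with hq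
  -- the reflected number state is homogeneous
  have hdeg : ∀ d ∈ q.support, d 0 + d 1 = j + k := by
    have h0 : (C σ * X 0 + C τ * X 1 : MvPolynomial (Fin 2) ℝ).IsHomogeneous 1 :=
      (isHomogeneous_C_mul_X _ _).add (isHomogeneous_C_mul_X _ _)
    have h1 : (C τ * X 0 - C σ * X 1 : MvPolynomial (Fin 2) ℝ).IsHomogeneous 1 :=
      (isHomogeneous_C_mul_X _ _).sub (isHomogeneous_C_mul_X _ _)
    have h2 : q.IsHomogeneous (1 * j + 1 * k) := by
      rw [hq, map_mul, map_pow, map_pow, reflect_X_zero, reflect_X_one]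
      exact (h0.pow j).mul (h1.pow k)
    intro d hd
    have h3 := h2 (mem_support_iff.mp hd)
    rw [Finsupp.weight_apply, Finsupp.sum_fintype _ _ (by simp)] at h3
    simpa using h3
  -- the effect of a displacement
  have hshift : ∀ z : ℝ, reflect σ τ ((X 0 + C (σ * z)) ^ j * (X 1 + C (τ * z)) ^ k) =
      ∑ d ∈ q.support, coeff d q • ((X 0 + C z) ^ d 0 * (X 1 + C 0) ^ d 1) := by
    intro z
    have h1 : reflect σ τ ((X 0 + C (σ * z)) ^ j * (X 1 + C (τ * z)) ^ k) =
        aeval ![X 0 + C z, X 1] q := by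
      have h2 : ∀ a, reflect σ τ (C a) = C a := fun a => by simp [reflect]
      have h3 : ∀ a, aeval ![X 0 + C z, X 1] (C a : MvPolynomial (Fin 2) ℝ) =
        (C a : MvPolynomial (Fin 2) ℝ) := fun a => by simp
      rw [hq]
      simp only [map_mul, map_pow, map_add, map_sub, reflect_X_zero, reflect_X_one, h2, h3, aeval_X,
        Matrix.cons_val_zero, Matrix.cons_val_one]
      congr 2 <;> ring
    rw [h1, aeval_def, eval₂_eq']
    refine Finset.sum_congr rfl fun d _ => ?_
    rw [Fin.prod_univ_two, ← C_mul']
    simp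
  have h1 := fockForm_reflect h ((X 0 + C (σ * 1)) ^ j * (X 1 + C (τ * 1)) ^ k)
    ((X 0 + C (σ * -x)) ^ j * (X 1 + C (τ * -x)) ^ k)
  rw [fockForm_shifted, shiftedOverlap_self, shiftedOverlap_self, hshift, hshift] at h1
  simp only [map_sum, LinearMap.sum_apply, map_smul, LinearMap.smul_apply, fockForm_shifted,
    smul_eq_mul, shiftedOverlap_zero] at h1
  have h2 : ∀ d ∈ q.support, ∑ e ∈ q.support, coeff d q * (coeff e q *
      (shiftedOverlap (e 0) (d 0) 1 (-x) * if e 1 = d 1 then ((e 1)! : ℝ) else 0)) =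
      coeff d q ^ 2 * ((d 0)! * (d 1)!) * laguerre (d 0) x := by
    intro d hd
    rw [Finset.sum_eq_single d]
    · rw [if_pos rfl, shiftedOverlap_self, one_mul, neg_neg]
      ring
    · intro e he hne
      rw [if_neg, mul_zero, mul_zero, mul_zero]
      intro h3
      apply hne
      have h4 := hdeg d hd
      have h5 := hdeg e he
      ext i
      fin_cases i
      · change e 0 = d 0
        omega
      · exact h3
    · exact fun h3 => absurd hd h3
  calc _ = j ! * laguerre j (-(σ * 1 * (σ * -x))) * (k ! * laguerre k (-(τ * 1 * (τ * -x)))) := by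
        ring_nf
    _ = _ := by
        rw [← h1]
        refine Finset.sum_congr rfl fun d hd => ?_
        rw [← h2 d hd, Finset.mul_sum]

end FockForm

/-- **Linearization.** The product `L_j(η x) L_k((1-η) x)` is a non-negative combination of Laguerre
polynomials at `x`. The coefficients are the photon-number distribution at one output of a
beamsplitter fed with the number states `j` and `k`. -/
lemma exists_laguerre_linearization {η : ℝ} (hη : η ∈ Icc (0 : ℝ) 1) (j k : ℕ) :
    ∃ b : ℕ →₀ ℝ, (∀ n, 0 ≤ b n) ∧ ∀ x, laguerre j (η * x) * laguerre k ((1 - η) * x) =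
      b.sum fun n a => a * laguerre n x := by
  have hσ : √η ^ 2 = η := Real.sq_sqrt hη.1
  have hτ : √(1 - η) ^ 2 = 1 - η := Real.sq_sqrt (by linarith [hη.2])
  have h := laguerre_mul_laguerre_eq_sum (σ := √η) (τ := √(1 - η)) (by rw [hσ, hτ]; ring) j k
  set q := reflect √η √(1 - η) (MvPolynomial.X 0 ^ j * MvPolynomial.X 1 ^ k)
  refine ⟨∑ d ∈ q.support, Finsupp.single (d 0)
    (MvPolynomial.coeff d q ^ 2 * ((d 0)! * (d 1)!) / (j ! * k !)), fun n => ?_, fun x => ?_⟩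
  · rw [Finsupp.finsetSum_apply]
    refine Finset.sum_nonneg fun d _ => ?_
    rw [Finsupp.single_apply]
    split_ifs
    · positivity
    · exact le_rfl
  · have h1 := h x
    rw [hσ, hτ] at h1
    have h2 : (j ! * k ! : ℝ) ≠ 0 := by positivity
    rw [← Finsupp.sum_finsetSum_index (by simp) (by intros; ring)]
    simp only [Finsupp.sum_single_index, zero_mul]
    rw [← mul_right_inj' h2, h1, Finset.mul_sum]
    refine Finset.sum_congr rfl fun d _ => ?_
    field_simp

/-! ### Characteristic functions -/

/-- The character `r ↦ exp (r s* - r* s)` of the additive group `ℂ`. -/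
noncomputable def symplecticChar (s r : ℂ) : ℂ :=
  Complex.exp (r * (starRingEnd ℂ) s - (starRingEnd ℂ) r * s)

lemma symplecticChar_eq_exp_inner (s r : ℂ) :
    symplecticChar s r = Complex.exp (2 * Complex.I * (inner ℝ (Complex.I * s) r : ℝ)) := by
  rw [symplecticChar]
  congr 1
  apply Complex.ext
  · simp [Complex.inner]
  · simp [Complex.inner]
    ring

lemma norm_symplecticChar (s r : ℂ) : ‖symplecticChar s r‖ = 1 := by
  rw [symplecticChar_eq_exp_inner, mul_comm 2, mul_assoc, mul_comm Complex.I]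
  exact_mod_cast Complex.norm_exp_ofReal_mul_I _

lemma continuous_symplecticChar (s : ℂ) : Continuous (symplecticChar s) := by
  unfold symplecticChar
  fun_prop

lemma integrable_mul_symplecticChar {f : ℂ → ℝ} (hf : Integrable f) (s : ℂ) :
    Integrable fun r => (f r : ℂ) * symplecticChar s r := by
  refine hf.ofReal.mul_bdd (c := 1) (continuous_symplecticChar s).aestronglyMeasurable ?_
  exact Filter.Eventually.of_forall fun r => (norm_symplecticChar s r).le

/-- The transform of `|r|^{2n} e^{-b|r|²}`, obtained from that of the Gaussian by differentiating
`n` times in `b`; the recurrence of the Laguerre polynomials is the derivative of the right side. -/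
lemma integral_pow_mul_exp_mul_symplecticChar (s : ℂ) (n : ℕ) {b : ℝ} (hb : 0 < b) :
    ∫ r : ℂ, ((‖r‖ ^ (2 * n) * Real.exp (-b * ‖r‖ ^ 2) : ℝ) : ℂ) * symplecticChar s r =
      ((Real.pi * n ! * b⁻¹ ^ (n + 1) * Real.exp (-(‖s‖ ^ 2 * b⁻¹)) *
        laguerre n (‖s‖ ^ 2 * b⁻¹) : ℝ) : ℂ) := by
  induction n generalizing b with
  | zero =>
    have h := GaussianFourier.integral_cexp_neg_mul_sq_norm_add (V := ℂ) (b := b)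
      (by simpa using hb) (2 * Complex.I) (Complex.I * s)
    rw [Complex.finrank_real_complex] at h
    have hb' : (b : ℂ) ≠ 0 := by exact_mod_cast hb.ne'
    convert! h using 1
    · congr 1 with r
      rw [symplecticChar_eq_exp_inner]
      push_cast
      rw [Complex.exp_add]
      simp
    · simp only [mul_pow, Complex.I_sq, norm_mul, Complex.norm_I, laguerre]
      simp
      rw [div_eq_mul_inv]
      congr 2
      field_simp
      norm_num
  | succ n ih =>
    set x := ‖s‖ ^ 2 with hx
    -- the left side
    have h1 : HasDerivAt (fun b : ℝ => ∫ r : ℂ,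
        ((‖r‖ ^ (2 * n) * Real.exp (-b * ‖r‖ ^ 2) : ℝ) : ℂ) * symplecticChar s r)
        (∫ r : ℂ, -(((‖r‖ ^ (2 * (n + 1)) * Real.exp (-b * ‖r‖ ^ 2) : ℝ) : ℂ) *
          symplecticChar s r)) b := by
      refine (hasDerivAt_integral_of_dominated_loc_of_deriv_le (𝕜 := ℝ) (μ := volume)
        (F := fun (b : ℝ) (r : ℂ) =>
          ((‖r‖ ^ (2 * n) * Real.exp (-b * ‖r‖ ^ 2) : ℝ) : ℂ) * symplecticChar s r)
        (F' := fun (b : ℝ) (r : ℂ) =>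
          -(((‖r‖ ^ (2 * (n + 1)) * Real.exp (-b * ‖r‖ ^ 2) : ℝ) : ℂ) * symplecticChar s r))
        (bound := fun r : ℂ => ‖r‖ ^ (2 * (n + 1)) * Real.exp (-(b / 2) * ‖r‖ ^ 2))
        (s := Ioi (b / 2)) (Ioi_mem_nhds (half_lt_self hb)) ?_ ?_ ?_ ?_ ?_ ?_).2
      · refine Filter.Eventually.of_forall fun c => ?_
        have := continuous_symplecticChar s
        exact Continuous.aestronglyMeasurable (by fun_prop)
      · exact integrable_mul_symplecticChar (integrable_pow_mul_exp_neg_mul_sq n hb) s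
      · have := continuous_symplecticChar s
        exact Continuous.aestronglyMeasurable (by fun_prop)
      · refine Filter.Eventually.of_forall fun r c hc => ?_
        rw [norm_neg, norm_mul, norm_symplecticChar, mul_one, Complex.norm_real, Real.norm_eq_abs,
          abs_of_nonneg (by positivity)]
        have : b / 2 ≤ c := hc.le
        gcongr
      · exact integrable_pow_mul_exp_neg_mul_sq (n + 1) (by linarith)
      · refine Filter.Eventually.of_forall fun r c _ => ?_
        have h : HasDerivAt (fun c : ℝ => ‖r‖ ^ (2 * n) * Real.exp (-c * ‖r‖ ^ 2))
            (-(‖r‖ ^ (2 * (n + 1)) * Real.exp (-c * ‖r‖ ^ 2))) c := by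
          convert! ((((hasDerivAt_id c).neg.mul_const (‖r‖ ^ 2)).exp).const_mul
            (‖r‖ ^ (2 * n))) using 1
          simp
          ring
        convert! h.ofReal_comp.mul_const (symplecticChar s r) using 1
        push_cast
        ring
    -- the right side
    have h2 : HasDerivAt (fun b : ℝ => Real.pi * n ! * b⁻¹ ^ (n + 1) * Real.exp (-(x * b⁻¹)) *
        laguerre n (x * b⁻¹)) (-(Real.pi * (n + 1)! * b⁻¹ ^ (n + 1 + 1) *
          Real.exp (-(x * b⁻¹)) * laguerre (n + 1) (x * b⁻¹))) b := by
      obtain ⟨d, hd, hrec⟩ := exists_hasDerivAt_laguerre n (x * b⁻¹)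
      have hi := hasDerivAt_inv hb.ne'
      have hxi := hi.const_mul x
      have h3 := (((hi.pow (n + 1)).const_mul (Real.pi * n !)).mul hxi.neg.exp).mul
        (hd.comp b hxi)
      refine h3.congr_deriv ?_
      have h4 : (-(b ^ 2)⁻¹ : ℝ) = -b⁻¹ ^ 2 := by rw [inv_pow]
      rw [h4, Nat.factorial_succ]
      simp only [Function.comp, Pi.pow_apply, Pi.mul_apply, Pi.neg_apply]
      push_cast
      linear_combination (Real.pi * n ! * b⁻¹ ^ (n + 2) * Real.exp (-(x * b⁻¹))) * hrec
    have h5 := h1.congr_of_eventuallyEq (f₁ := fun b : ℝ => ((Real.pi * n ! * b⁻¹ ^ (n + 1) *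
      Real.exp (-(x * b⁻¹)) * laguerre n (x * b⁻¹) : ℝ) : ℂ)) (by
        filter_upwards [Ioi_mem_nhds hb] with c hc using (ih hc).symm)
    have h6 := h5.unique h2.ofReal_comp
    rw [integral_neg, Complex.ofReal_neg, neg_inj] at h6
    exact h6

/-- The density on `ℂ` of the continuous counterpart of the number state `n`. -/
noncomputable def numberDensity (n : ℕ) (r : ℂ) : ℝ :=
  Real.exp (-‖r‖ ^ 2) * ‖r‖ ^ (2 * n) / ((n ! : ℝ) * Real.pi)

lemma numberDensity_nonneg (n : ℕ) (r : ℂ) : 0 ≤ numberDensity n r := by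
  unfold numberDensity
  positivity

lemma numberDensity_eq (n : ℕ) (r : ℂ) : numberDensity n r =
    ((n ! : ℝ) * Real.pi)⁻¹ * (‖r‖ ^ (2 * n) * Real.exp (-1 * ‖r‖ ^ 2)) := by
  rw [numberDensity, neg_one_mul]
  ring

lemma integrable_numberDensity (n : ℕ) : Integrable (numberDensity n) := by
  simp only [funext (numberDensity_eq n)]
  exact (integrable_pow_mul_exp_neg_mul_sq n one_pos).const_mul _

lemma integral_numberDensity (n : ℕ) : ∫ r, numberDensity n r = 1 := by
  simp only [numberDensity_eq, integral_const_mul, neg_one_mul, integral_pow_mul_exp_neg_sq]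
  have : (n ! : ℝ) ≠ 0 := by positivity
  field_simp

lemma numberDensity_le (n : ℕ) (r : ℂ) : numberDensity n r ≤ 1 := by
  have h := Real.pow_div_factorial_le_exp (‖r‖ ^ 2) (by positivity) n
  have hpi : (1 : ℝ) ≤ Real.pi := by linarith [Real.pi_gt_three]
  have h2 : numberDensity n r = Real.exp (-‖r‖ ^ 2) * ((‖r‖ ^ 2) ^ n / n !) / Real.pi := by
    rw [numberDensity, ← pow_mul]
    field_simp
  rw [h2]
  refine div_le_one_of_le₀ ?_ (by positivity)
  calc _ ≤ Real.exp (-‖r‖ ^ 2) * Real.exp (‖r‖ ^ 2) := by gcongr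
    _ = 1 := by rw [← Real.exp_add]; simp
    _ ≤ _ := hpi

lemma integral_numberDensity_mul_symplecticChar (n : ℕ) (s : ℂ) :
    ∫ r : ℂ, (numberDensity n r : ℂ) * symplecticChar s r =
      ((Real.exp (-‖s‖ ^ 2) * laguerre n (‖s‖ ^ 2) : ℝ) : ℂ) := by
  have h := integral_pow_mul_exp_mul_symplecticChar s n one_pos
  simp only [numberDensity_eq, Complex.ofReal_mul _⁻¹, mul_assoc, integral_const_mul] at h ⊢
  rw [h, ← Complex.ofReal_mul]
  congr 1
  have : (n ! : ℝ) ≠ 0 := by positivity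
  simp
  field_simp

/-- The characteristic function of the continuous counterpart is a Laguerre series. -/
lemma hasSum_integral_contLaw {p : ℕ → ℝ} (hp : IsMassFun p) (s : ℂ) :
    HasSum (fun n => ((p n * (Real.exp (-‖s‖ ^ 2) * laguerre n (‖s‖ ^ 2)) : ℝ) : ℂ))
      (∫ r, symplecticChar s r ∂contLaw p) := by
  have hs : ∀ r, Summable fun n => p n * numberDensity n r := fun r =>
    Summable.of_nonneg_of_le (fun n => mul_nonneg (hp.1 n) (numberDensity_nonneg n r))
      (fun n => mul_le_of_le_one_right (hp.1 n) (numberDensity_le n r)) hp.2.summable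
  have hmeas : Measurable (contDensity p) := by
    unfold contDensity
    refine Measurable.tsum fun n => ?_
    fun_prop
  have h1 : ∫ r, symplecticChar s r ∂contLaw p =
      ∫ r, ∑' n, ((p n * numberDensity n r : ℝ) : ℂ) * symplecticChar s r := by
    rw [contLaw, integral_withDensity_eq_integral_toReal_smul (by fun_prop) (by simp)]
    refine integral_congr_ae (Filter.Eventually.of_forall fun r => ?_)
    have h0 : 0 ≤ contDensity p r :=
      tsum_nonneg fun n => mul_nonneg (hp.1 n) (numberDensity_nonneg n r)
    simp only [ENNReal.toReal_ofReal h0]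
    rw [tsum_mul_right, ← Complex.ofReal_tsum]
    rfl
  rw [h1]
  have hint : ∀ n, Integrable fun r => ((p n * numberDensity n r : ℝ) : ℂ) * symplecticChar s r :=
    fun n => integrable_mul_symplecticChar ((integrable_numberDensity n).const_mul _) s
  convert! hasSum_integral_of_summable_integral_norm hint ?_ using 1
  · ext n
    simp only [Complex.ofReal_mul (p n), mul_assoc, integral_const_mul]
    rw [integral_numberDensity_mul_symplecticChar, ← Complex.ofReal_mul]
  · convert! hp.2.summable using 1
    ext n
    simp only [norm_mul, norm_symplecticChar, mul_one, Complex.norm_real, Real.norm_eq_abs,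
      abs_of_nonneg (hp.1 n), abs_of_nonneg (numberDensity_nonneg n _), integral_const_mul,
      integral_numberDensity]

/-- Sums of independent variables multiply characteristic functions; the coefficients rescale the
argument. -/
lemma integral_scaledSumLaw (η : ℝ) (ν₁ ν₂ : Measure ℂ) [SFinite ν₁] [SFinite ν₂] (s : ℂ) :
    ∫ r, symplecticChar s r ∂scaledSumLaw η ν₁ ν₂ =
      (∫ r, symplecticChar (√η * s) r ∂ν₁) * ∫ r, symplecticChar (√(1 - η) * s) r ∂ν₂ := by
  rw [scaledSumLaw, integral_map (by fun_prop) (continuous_symplecticChar s).aestronglyMeasurable,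
    ← integral_prod_mul]
  congr 1 with z
  simp only [symplecticChar]
  rw [← Complex.exp_add]
  congr 1
  simp
  ring

/-! ### The mass function of the beamsplitter sum -/

/-- Fubini for a mixture `∑ w_i b_i` of finitely supported weights, summed against `f`. -/
lemma hasSum_mixture {ι : Type*} {w : ι → ℝ} (hw : ∀ i, 0 ≤ w i) {b : ι → ℕ →₀ ℝ}
    (hb : ∀ i n, 0 ≤ b i n) {f : ℕ → ℝ}
    (h : Summable fun i => w i * (b i).sum fun n a => a * |f n|) :
    HasSum (fun n => (∑' i, w i * b i n) * f n)
      (∑' i, w i * (b i).sum fun n a => a * f n) := by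
  have hfin : ∀ (i : ι) (g : ℕ → ℝ), HasSum (fun n => w i * (b i n * g n))
      (w i * (b i).sum fun n a => a * g n) := fun i g => by
    refine HasSum.mul_left _ (hasSum_sum_of_ne_finset_zero fun n hn => ?_)
    rw [Finsupp.notMem_support_iff.mp hn, zero_mul]
  set F : ι × ℕ → ℝ := fun x => w x.1 * (b x.1 x.2 * f x.2) with hF
  have habs : ∀ x, |F x| = w x.1 * (b x.1 x.2 * |f x.2|) := fun x => by
    rw [hF, abs_mul, abs_mul, abs_of_nonneg (hw _), abs_of_nonneg (hb _ _)]
  have hsum : Summable F := by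
    refine Summable.of_abs ?_
    rw [summable_prod_of_nonneg fun x => abs_nonneg _]
    simp only [habs]
    refine ⟨fun i => (hfin i fun n => |f n|).summable, ?_⟩
    simpa only [(hfin _ fun n => |f n|).tsum_eq] using h
  have h1 : HasSum (fun i => w i * (b i).sum fun n a => a * f n) (∑' x, F x) :=
    hsum.hasSum.prod_fiberwise fun i => hfin i f
  have hswap : HasSum (F ∘ Equiv.prodComm ℕ ι) (∑' x, F x) :=
    (Equiv.prodComm ℕ ι).hasSum_iff.mpr hsum.hasSum
  have h2 : HasSum (fun n => ∑' i, w i * (b i n * f n)) (∑' x, F x) :=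
    hswap.prod_fiberwise fun n => (hswap.summable.prod_factor n).hasSum
  rw [h1.tsum_eq]
  convert! h2 using 2 with n
  rw [← tsum_mul_right]
  simp only [mul_assoc]

/-- The photon-number distribution at one output of a beamsplitter fed with the number states `j`
and `k`: the coefficients of `L_j(η x) L_k((1-η) x)` in the Laguerre basis. -/
noncomputable def outputDist {η : ℝ} (hη : η ∈ Icc (0 : ℝ) 1) (i : ℕ × ℕ) : ℕ →₀ ℝ :=
  (exists_laguerre_linearization hη i.1 i.2).choose

section Output
variable {η : ℝ} (hη : η ∈ Icc (0 : ℝ) 1)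

lemma outputDist_nonneg (i : ℕ × ℕ) (n : ℕ) : 0 ≤ outputDist hη i n :=
  (exists_laguerre_linearization hη i.1 i.2).choose_spec.1 n

lemma sum_outputDist_mul_laguerre (i : ℕ × ℕ) (x : ℝ) :
    ((outputDist hη i).sum fun n a => a * laguerre n x) =
      laguerre i.1 (η * x) * laguerre i.2 ((1 - η) * x) :=
  ((exists_laguerre_linearization hη i.1 i.2).choose_spec.2 x).symm

lemma sum_outputDist (i : ℕ × ℕ) : ((outputDist hη i).sum fun _ a => a) = 1 := by
  simpa [laguerre_apply_zero] using sum_outputDist_mul_laguerre hη i 0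

/-- The law of the number of photons at one output, for inputs with mass functions `p` and `q`. -/
noncomputable def outputMassFun (p q : ℕ → ℝ) (n : ℕ) : ℝ :=
  ∑' i : ℕ × ℕ, (p i.1 * q i.2) * outputDist hη i n

variable {p q : ℕ → ℝ}

lemma isMassFun_outputMassFun (hp : IsMassFun p) (hq : IsMassFun q) :
    IsMassFun (outputMassFun hη p q) := by
  have hw : ∀ i : ℕ × ℕ, 0 ≤ p i.1 * q i.2 := fun i => mul_nonneg (hp.1 _) (hq.1 _)
  refine ⟨fun n => tsum_nonneg fun i => mul_nonneg (hw i) (outputDist_nonneg hη i n), ?_⟩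
  have hs := hp.2.summable.mul_of_nonneg hq.2.summable hp.1 hq.1
  have h := hasSum_mixture (f := fun _ => 1) hw (outputDist_nonneg hη)
    (by simpa [sum_outputDist] using hs)
  simp only [mul_one, sum_outputDist] at h
  rwa [← hp.2.summable.tsum_mul_tsum hq.2.summable hs, hp.2.tsum_eq, hq.2.tsum_eq, mul_one] at h

lemma IsMassFun.summable_mul_laguerre (hp : IsMassFun p) {x : ℝ} (hx : 0 ≤ x) :
    Summable fun n => p n * laguerre n x := by
  refine Summable.of_norm_bounded (hp.2.summable.mul_right (Real.exp (x / 2))) fun n => ?_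
  rw [norm_mul, Real.norm_eq_abs, Real.norm_eq_abs, abs_of_nonneg (hp.1 n)]
  exact mul_le_mul_of_nonneg_left (abs_laguerre_le n hx) (hp.1 n)

lemma hasSum_outputMassFun_mul_laguerre (hp : IsMassFun p) (hq : IsMassFun q) {x : ℝ}
    (hx : 0 ≤ x) :
    HasSum (fun n => outputMassFun hη p q n * laguerre n x)
      ((∑' n, p n * laguerre n (η * x)) * ∑' n, q n * laguerre n ((1 - η) * x)) := by
  have hw : ∀ i : ℕ × ℕ, 0 ≤ p i.1 * q i.2 := fun i => mul_nonneg (hp.1 _) (hq.1 _)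
  have hs := hp.2.summable.mul_of_nonneg hq.2.summable hp.1 hq.1
  have hη' : 0 ≤ 1 - η := by linarith [hη.2]
  have hbound : ∀ i, ((outputDist hη i).sum fun n a => a * |laguerre n x|) ≤ Real.exp (x / 2) := by
    intro i
    calc ((outputDist hη i).sum fun n a => a * |laguerre n x|)
        ≤ (outputDist hη i).sum fun n a => a * Real.exp (x / 2) :=
          Finset.sum_le_sum fun n _ =>
            mul_le_mul_of_nonneg_left (abs_laguerre_le n hx) (outputDist_nonneg hη i n)
      _ = _ := by rw [← Finsupp.sum_mul, sum_outputDist, one_mul]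
  have h := hasSum_mixture (f := fun n => laguerre n x) hw (outputDist_nonneg hη)
    (Summable.of_nonneg_of_le (fun i => mul_nonneg (hw i) (Finset.sum_nonneg fun n _ =>
      mul_nonneg (outputDist_nonneg hη i n) (abs_nonneg _)))
      (fun i => mul_le_mul_of_nonneg_left (hbound i) (hw i)) (hs.mul_right _))
  simp only [sum_outputDist_mul_laguerre] at h
  have h1 := (hp.summable_mul_laguerre (mul_nonneg hη.1 hx)).norm
  have h2 := (hq.summable_mul_laguerre (mul_nonneg hη' hx)).norm
  rw [tsum_mul_tsum_of_summable_norm h1 h2]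
  convert! h using 3 with i
  ring

lemma tsum_mul_exp_neg_mul_laguerre (p : ℕ → ℝ) {σ : ℝ} (hσ : 0 ≤ σ) (s : ℂ) :
    ∑' n, p n * (Real.exp (-‖(√σ : ℂ) * s‖ ^ 2) * laguerre n (‖(√σ : ℂ) * s‖ ^ 2)) =
      Real.exp (-(σ * ‖s‖ ^ 2)) * ∑' n, p n * laguerre n (σ * ‖s‖ ^ 2) := by
  have h : ‖(√σ : ℂ) * s‖ ^ 2 = σ * ‖s‖ ^ 2 := by
    rw [norm_mul, mul_pow, Complex.norm_real, Real.norm_eq_abs, sq_abs, Real.sq_sqrt hσ]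
  rw [h, ← tsum_mul_left]
  congr 1 with n
  ring

/-- The characteristic function of the sum law, expanded in Laguerre polynomials. -/
lemma integral_symplecticChar_scaledSumLaw (hp : IsMassFun p) (hq : IsMassFun q) (s : ℂ) :
    ∫ r, symplecticChar s r ∂scaledSumLaw η (contLaw p) (contLaw q) =
      ((Real.exp (-‖s‖ ^ 2) * ∑' m, outputMassFun hη p q m * laguerre m (‖s‖ ^ 2) : ℝ) : ℂ) := by
  have hη' : 0 ≤ 1 - η := by linarith [hη.2]
  have : SFinite (contLaw p) := by unfold contLaw; infer_instance
  have : SFinite (contLaw q) := by unfold contLaw; infer_instance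
  rw [integral_scaledSumLaw, ← (hasSum_integral_contLaw hp _).tsum_eq,
    ← (hasSum_integral_contLaw hq _).tsum_eq, ← Complex.ofReal_tsum, ← Complex.ofReal_tsum,
    tsum_mul_exp_neg_mul_laguerre p hη.1, tsum_mul_exp_neg_mul_laguerre q hη', ← Complex.ofReal_mul,
    (hasSum_outputMassFun_mul_laguerre hη hp hq (sq_nonneg ‖s‖)).tsum_eq, mul_mul_mul_comm,
    ← Real.exp_add]
  ring_nf

/-- The inverse transform recovers the mass function from a Laguerre expansion of the
characteristic function, by orthogonality. -/
lemma integral_tsum_mul_laguerre {p : ℕ → ℝ} (hp : IsMassFun p) (n : ℕ) :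
    ∫ s : ℂ, (Real.exp (-‖s‖ ^ 2) * ∑' m, p m * laguerre m (‖s‖ ^ 2)) * laguerre n (‖s‖ ^ 2) =
      Real.pi * p n := by
  have hcont := continuous_laguerre
  have hbd := (integrable_laguerre_mul_exp n (b := 1 / 2) (by norm_num)).norm
  have hle : ∀ m (s : ℂ), ‖laguerre m (‖s‖ ^ 2) * laguerre n (‖s‖ ^ 2) * Real.exp (-‖s‖ ^ 2)‖ ≤
      ‖laguerre n (‖s‖ ^ 2) * Real.exp (-(1 / 2) * ‖s‖ ^ 2)‖ := by
    intro m s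
    rw [norm_mul, norm_mul, norm_mul, Real.norm_eq_abs, Real.norm_eq_abs, Real.norm_eq_abs,
      Real.norm_eq_abs, Real.abs_exp, Real.abs_exp]
    calc _ ≤ Real.exp (‖s‖ ^ 2 / 2) * |laguerre n (‖s‖ ^ 2)| * Real.exp (-‖s‖ ^ 2) := by
          gcongr
          exact abs_laguerre_le m (sq_nonneg _)
      _ = |laguerre n (‖s‖ ^ 2)| * (Real.exp (‖s‖ ^ 2 / 2) * Real.exp (-‖s‖ ^ 2)) := by ring
      _ = _ := by
          rw [← Real.exp_add]
          ring_nf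
  have hint : ∀ m, Integrable fun s : ℂ =>
      laguerre m (‖s‖ ^ 2) * laguerre n (‖s‖ ^ 2) * Real.exp (-‖s‖ ^ 2) := fun m =>
    hbd.mono' (Continuous.aestronglyMeasurable (by fun_prop)) (Filter.Eventually.of_forall (hle m))
  have h := hasSum_integral_of_summable_integral_norm (fun m => (hint m).const_mul (p m)) (by
    refine Summable.of_nonneg_of_le (fun m => integral_nonneg fun s => norm_nonneg _) (fun m => ?_)
      (hp.2.summable.mul_right
        (∫ s : ℂ, ‖laguerre n (‖s‖ ^ 2) * Real.exp (-(1 / 2) * ‖s‖ ^ 2)‖))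
    simp only [norm_mul (p m), integral_const_mul, Real.norm_of_nonneg (hp.1 m)]
    exact mul_le_mul_of_nonneg_left (integral_mono (hint m).norm hbd (hle m)) (hp.1 m))
  simp only [integral_const_mul, integral_laguerre_mul_laguerre, mul_ite, mul_zero] at h
  have h2 := h.tsum_eq
  rw [tsum_ite_eq] at h2
  rw [mul_comm, h2]
  congr 1 with s
  rw [mul_right_comm, mul_comm, ← tsum_mul_right]
  congr 1 with m
  ring

/-- Beamsplitter addition is the photon-number statistics of the beamsplitter. -/
lemma beamsplitterAdd_eq (hp : IsMassFun p) (hq : IsMassFun q) :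
    beamsplitterAdd η p q = outputMassFun hη p q := by
  ext n
  have h := integral_tsum_mul_laguerre (isMassFun_outputMassFun hη hp hq) n
  have h1 : ∀ s : ℂ, (∫ r : ℂ, Complex.exp (r * (starRingEnd ℂ) s - (starRingEnd ℂ) r * s)
      ∂scaledSumLaw η (contLaw p) (contLaw q)) * (laguerre n (‖s‖ ^ 2) : ℂ) =
      (((Real.exp (-‖s‖ ^ 2) * ∑' m, outputMassFun hη p q m * laguerre m (‖s‖ ^ 2)) *
        laguerre n (‖s‖ ^ 2) : ℝ) : ℂ) := fun s => by
    rw [Complex.ofReal_mul, ← integral_symplecticChar_scaledSumLaw hη hp hq s]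
    rfl
  rw [beamsplitterAdd, contLawInv]
  simp only [h1]
  rw [integral_complex_ofReal, h, one_div, ← Complex.ofReal_inv, ← Complex.ofReal_mul,
    Complex.ofReal_re]
  field_simp

end Output

/-! ### Falling moments -/

/-- The polynomial `t ↦ L_n(-t)`. Its coefficients are `n(n-1)⋯(n-m+1) / (m!)²`. -/
noncomputable def laguerrePoly (n : ℕ) : Polynomial ℝ :=
  ∑ m ∈ Finset.range (n + 1),
    Polynomial.monomial m ((n.descFactorial m : ℝ) / (m ! : ℝ) / (m ! : ℝ))

lemma coeff_laguerrePoly (n m : ℕ) :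
    (laguerrePoly n).coeff m = (n.descFactorial m : ℝ) / (m ! : ℝ) / (m ! : ℝ) := by
  simp only [laguerrePoly, Polynomial.finsetSum_coeff, Polynomial.coeff_monomial]
  rw [Finset.sum_ite_eq']
  split_ifs with h
  · rfl
  · rw [Nat.descFactorial_of_lt (by simpa using h)]
    simp

lemma eval_laguerrePoly (n : ℕ) (t : ℝ) : (laguerrePoly n).eval t = laguerre n (-t) := by
  simp only [laguerrePoly, Polynomial.eval_finsetSum, Polynomial.eval_monomial, laguerre, neg_neg]
  refine Finset.sum_congr rfl fun m _ => ?_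
  have : (m ! : ℝ) ≠ 0 := by positivity
  rw [Nat.descFactorial_eq_factorial_mul_choose]
  push_cast
  field_simp

/-- The coefficient `E (X)_(m) / (m!)²` of the exponential generating function. -/
noncomputable def expGenCoeff (p : ℕ → ℝ) (m : ℕ) : ℝ :=
  fallingMoment p m / (m ! : ℝ) / (m ! : ℝ)

section Output
variable {η : ℝ} (hη : η ∈ Icc (0 : ℝ) 1)

/-- Comparison of the coefficients of `x^m` in the linearization formula. -/
lemma sum_outputDist_mul_descFactorial (i : ℕ × ℕ) (m : ℕ) :
    ((outputDist hη i).sum fun n a => a * ((n.descFactorial m : ℝ) / (m ! : ℝ) / (m ! : ℝ))) =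
      ∑ l ∈ Finset.HasAntidiagonal.antidiagonal m,
        (η ^ l.1 * ((i.1.descFactorial l.1 : ℝ) / (l.1 ! : ℝ) / (l.1 ! : ℝ))) *
          ((1 - η) ^ l.2 * ((i.2.descFactorial l.2 : ℝ) / (l.2 ! : ℝ) / (l.2 ! : ℝ))) := by
  have h : ((laguerrePoly i.1).comp (Polynomial.C η * Polynomial.X)) *
      ((laguerrePoly i.2).comp (Polynomial.C (1 - η) * Polynomial.X)) =
      (outputDist hη i).sum fun n a => Polynomial.C a * laguerrePoly n := by
    refine Polynomial.funext fun t => ?_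
    have h1 := sum_outputDist_mul_laguerre hη i (-t)
    simp only [Finsupp.sum] at h1 ⊢
    simp only [Polynomial.eval_finsetSum, Polynomial.eval_mul, Polynomial.eval_C,
      eval_laguerrePoly, Polynomial.eval_comp, Polynomial.eval_X, h1, mul_neg]
  have h2 := congr_arg (fun P => Polynomial.coeff P m) h
  simp only [Finsupp.sum, Polynomial.finsetSum_coeff, Polynomial.coeff_C_mul] at h2
  rw [Polynomial.coeff_mul] at h2
  simp only [Polynomial.comp_C_mul_X_coeff, coeff_laguerrePoly] at h2
  rw [Finsupp.sum, ← h2]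
  refine Finset.sum_congr rfl fun l _ => ?_
  ring

variable {p q : ℕ → ℝ}

lemma FiniteMoments.hasSum (hp : FiniteMoments p) (m : ℕ) :
    HasSum (fun n => p n * ((n.descFactorial m : ℝ) / (m ! : ℝ) / (m ! : ℝ)))
      (expGenCoeff p m) := by
  convert! (((hp m).hasSum.div_const (m ! : ℝ)).div_const (m ! : ℝ)) using 2 with n
  ring

/-- The coefficients of the exponential generating functions of a beamsplitter sum are the
convolution of those of the summands. -/
lemma hasSum_outputMassFun_mul_descFactorial (hp : IsMassFun p) (hq : IsMassFun q)
    (hpm : FiniteMoments p) (hqm : FiniteMoments q) (m : ℕ) :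
    HasSum (fun n => outputMassFun hη p q n * ((n.descFactorial m : ℝ) / (m ! : ℝ) / (m ! : ℝ)))
      (∑ l ∈ Finset.HasAntidiagonal.antidiagonal m,
        (η ^ l.1 * expGenCoeff p l.1) * ((1 - η) ^ l.2 * expGenCoeff q l.2)) := by
  have hw : ∀ i : ℕ × ℕ, 0 ≤ p i.1 * q i.2 := fun i => mul_nonneg (hp.1 _) (hq.1 _)
  have h1 : HasSum (fun i : ℕ × ℕ => p i.1 * q i.2 * (outputDist hη i).sum fun n a =>
      a * ((n.descFactorial m : ℝ) / (m ! : ℝ) / (m ! : ℝ)))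
      (∑ l ∈ Finset.HasAntidiagonal.antidiagonal m,
        (η ^ l.1 * expGenCoeff p l.1) * ((1 - η) ^ l.2 * expGenCoeff q l.2)) := by
    simp only [sum_outputDist_mul_descFactorial, Finset.mul_sum]
    refine hasSum_sum fun l _ => ?_
    have h2 := (hpm.hasSum l.1).mul_left (η ^ l.1)
    have h3 := (hqm.hasSum l.2).mul_left ((1 - η) ^ l.2)
    have h4 := h2.mul h3 (h2.summable.mul_of_nonneg h3.summable
      (fun n => mul_nonneg (pow_nonneg hη.1 _) (mul_nonneg (hp.1 n) (by positivity)))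
      (fun n => mul_nonneg (pow_nonneg (by linarith [hη.2]) _)
        (mul_nonneg (hq.1 n) (by positivity))))
    convert! h4 using 2 with i
    ring
  have habs : ∀ n : ℕ, |(n.descFactorial m : ℝ) / (m ! : ℝ) / (m ! : ℝ)| =
      (n.descFactorial m : ℝ) / (m ! : ℝ) / (m ! : ℝ) := fun n => abs_of_nonneg (by positivity)
  have h5 := hasSum_mixture (f := fun n => (n.descFactorial m : ℝ) / (m ! : ℝ) / (m ! : ℝ)) hw
    (outputDist_nonneg hη) (by simpa only [habs] using h1.summable)
  rwa [h1.tsum_eq] at h5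

lemma finiteMoments_outputMassFun (hp : IsMassFun p) (hq : IsMassFun q)
    (hpm : FiniteMoments p) (hqm : FiniteMoments q) : FiniteMoments (outputMassFun hη p q) := by
  intro m
  have h := (hasSum_outputMassFun_mul_descFactorial hη hp hq hpm hqm m).summable.mul_left
    ((m ! : ℝ) * m !)
  convert! h using 2 with n
  have : (m ! : ℝ) ≠ 0 := by positivity
  field_simp

lemma expGenCoeff_outputMassFun (hp : IsMassFun p) (hq : IsMassFun q)
    (hpm : FiniteMoments p) (hqm : FiniteMoments q) (m : ℕ) :
    expGenCoeff (outputMassFun hη p q) m = ∑ l ∈ Finset.HasAntidiagonal.antidiagonal m,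
      (η ^ l.1 * expGenCoeff p l.1) * ((1 - η) ^ l.2 * expGenCoeff q l.2) :=
  ((finiteMoments_outputMassFun hη hp hq hpm hqm).hasSum m).unique
    (hasSum_outputMassFun_mul_descFactorial hη hp hq hpm hqm m)

lemma expGenSeries_outputMassFun (hp : IsMassFun p) (hq : IsMassFun q)
    (hpm : FiniteMoments p) (hqm : FiniteMoments q) :
    expGenSeries (outputMassFun hη p q) = PowerSeries.rescale η (expGenSeries p) *
      PowerSeries.rescale (1 - η) (expGenSeries q) := by
  ext m
  rw [PowerSeries.coeff_mul]
  simp only [PowerSeries.coeff_rescale, expGenSeries, PowerSeries.coeff_mk]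
  exact expGenCoeff_outputMassFun hη hp hq hpm hqm m

lemma expGen_term_eq (p : ℕ → ℝ) (t : ℝ) (m : ℕ) :
    t ^ m / (m ! : ℝ) * (fallingMoment p m / (m ! : ℝ)) = t ^ m * expGenCoeff p m := by
  rw [expGenCoeff]
  ring

lemma expGen_outputMassFun (hp : IsMassFun p) (hq : IsMassFun q) {t : ℝ}
    (hpt : ExpGenConverges p (η * t)) (hqt : ExpGenConverges q ((1 - η) * t)) :
    ExpGenConverges (outputMassFun hη p q) t ∧
      expGenFun (outputMassFun hη p q) t = expGenFun p (η * t) * expGenFun q ((1 - η) * t) := by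
  obtain ⟨hpm, hps⟩ := hpt
  obtain ⟨hqm, hqs⟩ := hqt
  simp only [ExpGenConverges, expGenFun, expGen_term_eq] at hps hqs ⊢
  have h : ∀ m, t ^ m * expGenCoeff (outputMassFun hη p q) m =
      ∑ l ∈ Finset.HasAntidiagonal.antidiagonal m,
        ((η * t) ^ l.1 * expGenCoeff p l.1) * (((1 - η) * t) ^ l.2 * expGenCoeff q l.2) := by
    intro m
    rw [expGenCoeff_outputMassFun hη hp hq hpm hqm, Finset.mul_sum]
    refine Finset.sum_congr rfl fun l hl => ?_
    rw [← Finset.HasAntidiagonal.mem_antidiagonal.mp hl, mul_pow, mul_pow, pow_add]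
    ring
  simp only [h]
  exact ⟨⟨finiteMoments_outputMassFun hη hp hq hpm hqm,
    (summable_norm_sum_mul_antidiagonal_of_summable_norm hps.norm hqs.norm).of_norm⟩,
    (tsum_mul_tsum_eq_tsum_sum_antidiagonal_of_summable_norm hps.norm hqs.norm).symm⟩

end Output

/-! ### Uniqueness for the Laplace transform -/

/-- **Lerch's theorem**, at the non-negative integers: a function whose Laplace transform vanishes
at every `k : ℕ` vanishes almost everywhere. By Weierstrass, every test function is a uniform limit
of polynomials in `e^{-t}`. -/
lemma ae_eq_zero_of_laplace_eq_zero {G : ℝ → ℝ} (hG : IntegrableOn G (Ioi 0))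
    (h : ∀ k : ℕ, ∫ t in Ioi 0, Real.exp (-t) ^ k * G t = 0) :
    ∀ᵐ t, t ∈ Ioi (0 : ℝ) → G t = 0 := by
  have hbdd : ∀ P : Polynomial ℝ, ∃ C, ∀ t ∈ Ioi (0 : ℝ), |P.eval (Real.exp (-t))| ≤ C := by
    intro P
    obtain ⟨C, hC⟩ := (isCompact_Icc (a := (0 : ℝ)) (b := 1)).exists_bound_of_continuousOn
      P.continuous.continuousOn
    refine ⟨C, fun t ht => hC _ ⟨(Real.exp_pos _).le, ?_⟩⟩
    simpa using le_of_lt ht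
  have hPint : ∀ P : Polynomial ℝ,
      IntegrableOn (fun t => P.eval (Real.exp (-t)) * G t) (Ioi 0) := by
    intro P
    obtain ⟨C, hC⟩ := hbdd P
    refine hG.bdd_mul (c := C) ?_ ?_
    · exact (P.continuous.comp (by fun_prop : Continuous fun t : ℝ => Real.exp (-t)))
        |>.aestronglyMeasurable
    · exact (ae_restrict_mem measurableSet_Ioi).mono fun t ht => hC t ht
  have hP : ∀ P : Polynomial ℝ, ∫ t in Ioi 0, P.eval (Real.exp (-t)) * G t = 0 := by
    intro P
    induction P using Polynomial.induction_on' with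
    | add P Q hP hQ =>
      simp only [Polynomial.eval_add, add_mul]
      rw [integral_add (hPint P) (hPint Q), hP, hQ, add_zero]
    | monomial n a =>
      simp only [Polynomial.eval_monomial, mul_assoc]
      rw [integral_const_mul, h, mul_zero]
  refine isOpen_Ioi.ae_eq_zero_of_integral_contDiff_smul_eq_zero hG.locallyIntegrableOn ?_
  intro g hg hgc hgs
  have hg0 : ∀ t ∉ Ioi (0 : ℝ), g t = 0 := fun t ht =>
    image_eq_zero_of_notMem_tsupport fun h => ht (hgs h)
  -- the test function in the variable `y = e^{-t}`; it vanishes near `y = 0`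
  have hψ : ContinuousOn (fun y : ℝ => g (-Real.log y)) (Icc 0 1) := by
    refine Continuous.continuousOn (continuous_iff_continuousAt.mpr fun y => ?_)
    rcases eq_or_ne y 0 with rfl | hy
    · obtain ⟨R, hR⟩ := hgc.isCompact.isBounded.exists_norm_le
      have hev : (fun y : ℝ => g (-Real.log y)) =ᶠ[nhds 0] fun _ => 0 := by
        filter_upwards [Metric.ball_mem_nhds (0 : ℝ) (Real.exp_pos (-R))] with y hy
        rcases eq_or_ne y 0 with rfl | hy0
        · exact hg0 _ (by simp)
        · refine image_eq_zero_of_notMem_tsupport fun hmem => ?_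
          have h1 := hR _ hmem
          rw [mem_ball_zero_iff, Real.norm_eq_abs] at hy
          have h2 := Real.log_lt_log (abs_pos.mpr hy0) hy
          rw [Real.log_exp, Real.log_abs] at h2
          have h3 := (le_abs_self _).trans h1
          linarith
      exact (continuousAt_const.congr hev.symm)
    · exact hg.continuous.continuousAt.comp (Real.continuousAt_log hy).neg
  have hK : 0 ≤ ∫ t in Ioi 0, |G t| := integral_nonneg fun t => abs_nonneg _
  have hgG : IntegrableOn (fun t => g t * G t) (Ioi 0) := by
    obtain ⟨C, hC⟩ := hg.continuous.bounded_above_of_compact_support hgc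
    exact hG.bdd_mul hg.continuous.aestronglyMeasurable (Filter.Eventually.of_forall hC)
  simp only [smul_eq_mul]
  rw [← setIntegral_eq_integral_of_forall_compl_eq_zero (s := Ioi 0)
    fun t ht => by rw [hg0 t ht, zero_mul]]
  have hle : ∀ ε > 0, |∫ t in Ioi 0, g t * G t| ≤ ε * ∫ t in Ioi 0, |G t| := by
    intro ε hε
    obtain ⟨P, hPε⟩ := exists_polynomial_near_of_continuousOn 0 1 _ hψ ε hε
    have h1 : ∫ t in Ioi 0, g t * G t =
        ∫ t in Ioi 0, (g t * G t - P.eval (Real.exp (-t)) * G t) := by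
      rw [integral_sub hgG (hPint P), hP, sub_zero]
    rw [h1, ← integral_const_mul, ← Real.norm_eq_abs]
    refine norm_integral_le_of_norm_le (hG.abs.const_mul ε) ?_
    refine (ae_restrict_mem measurableSet_Ioi).mono fun t ht => ?_
    have h2 := hPε (Real.exp (-t)) ⟨(Real.exp_pos _).le, by simpa using le_of_lt ht⟩
    rw [Real.log_exp, neg_neg, abs_sub_comm] at h2
    rw [← sub_mul, Real.norm_eq_abs, abs_mul]
    gcongr
  by_contra hne
  have hpos : 0 < |∫ t in Ioi 0, g t * G t| := abs_pos.mpr hne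
  have h1 := hle (|∫ t in Ioi 0, g t * G t| / (2 * ((∫ t in Ioi 0, |G t|) + 1))) (by positivity)
  rw [div_mul_eq_mul_div, le_div_iff₀ (by positivity)] at h1
  nlinarith

/-- Two continuous functions with the same Laplace transform on a half-line agree. -/
lemma eqOn_of_hasLaplace {f g F : ℝ → ℝ} {s₀ : ℝ} (hf : ContinuousOn f (Ioi 0))
    (hg : ContinuousOn g (Ioi 0)) (hfF : ∀ s, s₀ ≤ s → HasLaplace f s (F s))
    (hgF : ∀ s, s₀ ≤ s → HasLaplace g s (F s)) : EqOn f g (Ioi 0) := by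
  have h1 : ∀ᵐ t, t ∈ Ioi (0 : ℝ) →
      Real.exp (-(s₀ * t)) * f t - Real.exp (-(s₀ * t)) * g t = 0 := by
    refine ae_eq_zero_of_laplace_eq_zero ((hfF s₀ le_rfl).1.sub (hgF s₀ le_rfl).1) fun k => ?_
    have hk : s₀ ≤ s₀ + k := by simp
    have h2 : ∀ t : ℝ, Real.exp (-t) ^ k *
        (Real.exp (-(s₀ * t)) * f t - Real.exp (-(s₀ * t)) * g t) =
        Real.exp (-((s₀ + k) * t)) * f t - Real.exp (-((s₀ + k) * t)) * g t := by
      intro t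
      rw [← Real.exp_nat_mul, add_mul, neg_add, Real.exp_add, mul_neg]
      ring
    simp only [h2]
    rw [integral_sub (hfF _ hk).1 (hgF _ hk).1, (hfF _ hk).2, (hgF _ hk).2, sub_self]
  refine Measure.eqOn_open_of_ae_eq (μ := volume) ?_ isOpen_Ioi hf hg
  rw [Filter.EventuallyEq, ae_restrict_iff' measurableSet_Ioi]
  filter_upwards [h1] with t ht h0
  have h2 := ht h0
  rw [← mul_sub, mul_eq_zero, sub_eq_zero] at h2
  exact h2.resolve_left (Real.exp_pos _).ne'

/-! ### Ordinary generating functions and Laplace transforms -/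

variable {p : ℕ → ℝ} {c : ℝ}

/-- The inverse Laplace transform of `(s-c)⁻¹ H(c/(s-c))`: up to the factor `e^{ct}`, it is the
exponential generating function at `c t`. -/
noncomputable def invLaplace (c : ℝ) (p : ℕ → ℝ) (t : ℝ) : ℝ :=
  Real.exp (c * t) * expGenFun p (c * t)

lemma fallingMoment_nonneg (hp : IsMassFun p) (m : ℕ) : 0 ≤ fallingMoment p m :=
  tsum_nonneg fun n => mul_nonneg (by positivity) (hp.1 n)

lemma fallingMoment_zero (hp : IsMassFun p) : fallingMoment p 0 = 1 := by
  simpa [fallingMoment] using hp.2.tsum_eq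

lemma mem_ordDomain_of_le (hp : IsMassFun p) (hc : 0 ≤ c) {s s' : ℝ} (hs : s ∈ ordDomain c p)
    (hss' : s ≤ s') : s' ∈ ordDomain c p := by
  obtain ⟨hcs, hm, hsum⟩ := hs
  have h0 : 0 < s - c := sub_pos.mpr hcs
  refine ⟨hcs.trans_le hss', hm, Summable.of_nonneg_of_le (fun m => ?_) (fun m => ?_) hsum⟩
  · have := fallingMoment_nonneg hp m
    have : 0 < s' - c := by linarith
    positivity
  · have := fallingMoment_nonneg hp m
    have : 0 < s' - c := by linarith
    gcongr

/-- On the domain of the ordinary generating function the moments grow at most geometrically, up to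
the factor `m!`. -/
lemma exists_moment_bound (hp : IsMassFun p) (hc : 0 ≤ c) {s : ℝ} (hs : s ∈ ordDomain c p) :
    ∃ K, ∀ m, c ^ m * (fallingMoment p m / (m ! : ℝ)) ≤ K * (s - c) ^ m := by
  obtain ⟨hcs, hm, hsum⟩ := hs
  have h0 : 0 < s - c := sub_pos.mpr hcs
  refine ⟨∑' m, (c / (s - c)) ^ m * (fallingMoment p m / (m ! : ℝ)), fun m => ?_⟩
  have h1 := hsum.le_tsum m fun j _ => by
    have := fallingMoment_nonneg hp j
    positivity
  rw [div_pow, div_mul_eq_mul_div, div_le_iff₀ (by positivity)] at h1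
  exact h1

lemma abs_expGen_term_le (hp : IsMassFun p) (hc : 0 ≤ c) {s K : ℝ}
    (hK : ∀ m, c ^ m * (fallingMoment p m / (m ! : ℝ)) ≤ K * (s - c) ^ m) {R t : ℝ}
    (ht : |t| ≤ R) (m : ℕ) :
    ‖(c * t) ^ m / (m ! : ℝ) * (fallingMoment p m / (m ! : ℝ))‖ ≤
      K * ((R * (s - c)) ^ m / (m ! : ℝ)) := by
  have h1 := fallingMoment_nonneg hp m
  have hR : 0 ≤ R := (abs_nonneg t).trans ht
  rw [Real.norm_eq_abs, abs_mul, abs_div, abs_pow, abs_mul, abs_of_nonneg hc,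
    abs_of_nonneg (by positivity : (0 : ℝ) ≤ m !),
    abs_of_nonneg (by positivity : 0 ≤ fallingMoment p m / (m ! : ℝ))]
  calc (c * |t|) ^ m / (m ! : ℝ) * (fallingMoment p m / (m ! : ℝ))
      = |t| ^ m * (c ^ m * (fallingMoment p m / (m ! : ℝ))) / (m ! : ℝ) := by ring
    _ ≤ R ^ m * (K * (s - c) ^ m) / (m ! : ℝ) := by
        have h2 : 0 ≤ c ^ m * (fallingMoment p m / (m ! : ℝ)) := by positivity
        have := hK m
        gcongr
    _ = _ := by
        rw [mul_pow]
        ring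

lemma expGenConverges_of_mem_ordDomain (hp : IsMassFun p) (hc : 0 ≤ c) {s : ℝ}
    (hs : s ∈ ordDomain c p) (t : ℝ) : ExpGenConverges p (c * t) := by
  obtain ⟨K, hK⟩ := exists_moment_bound hp hc hs
  exact ⟨hs.2.1, Summable.of_norm_bounded
    ((Real.summable_pow_div_factorial _).mul_left K) (abs_expGen_term_le hp hc hK le_rfl)⟩

lemma continuous_invLaplace (hp : IsMassFun p) (hc : 0 ≤ c) {s : ℝ} (hs : s ∈ ordDomain c p) :
    Continuous (invLaplace c p) := by
  obtain ⟨K, hK⟩ := exists_moment_bound hp hc hs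
  refine (by fun_prop : Continuous fun t => Real.exp (c * t)).mul ?_
  refine continuous_iff_continuousAt.mpr fun t => ?_
  have h : ContinuousOn (fun t => expGenFun p (c * t)) (Metric.ball 0 (|t| + 1)) := by
    unfold expGenFun
    refine continuousOn_tsum (fun m => Continuous.continuousOn (by fun_prop))
      ((Real.summable_pow_div_factorial ((|t| + 1) * (s - c))).mul_left K) fun m x hx => ?_
    refine abs_expGen_term_le hp hc hK ?_ m
    rw [mem_ball_zero_iff] at hx
    exact hx.le
  exact h.continuousAt (Metric.isOpen_ball.mem_nhds (by simp))

lemma integral_pow_mul_exp_neg_mul (m : ℕ) {u : ℝ} (hu : 0 < u) :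
    ∫ t in Ioi 0, t ^ m * Real.exp (-(u * t)) = m ! / u ^ (m + 1) := by
  have h := Real.integral_rpow_mul_exp_neg_mul_Ioi (a := m + 1) (by positivity) hu
  simp only [add_sub_cancel_right, Real.rpow_natCast] at h
  rw [h, Real.Gamma_nat_eq_factorial]
  have h2 : (1 / u) ^ ((m : ℝ) + 1) = (1 / u) ^ (m + 1) := by exact_mod_cast Real.rpow_natCast _ _
  rw [h2, one_div, inv_pow]
  field_simp

lemma hasLaplace_invLaplace (hp : IsMassFun p) (hc : 0 ≤ c) {s : ℝ} (hs : s ∈ ordDomain c p) :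
    HasLaplace (invLaplace c p) s (1 / (s - c) * ordGenFun p (c / (s - c))) := by
  have hu : 0 < s - c := sub_pos.mpr hs.1
  set u := s - c with hu_def
  have hsum := hs.2.2
  rw [← hu_def] at hsum
  set A : ℕ → ℝ := fun m => c ^ m * (fallingMoment p m / (m ! : ℝ)) / (m ! : ℝ) with hA
  have hA0 : ∀ m, 0 ≤ A m := fun m => by
    have := fallingMoment_nonneg hp m
    positivity
  have hint : ∀ m, ∫ t in Ioi 0, A m * (t ^ m * Real.exp (-(u * t))) =
      1 / u * ((c / u) ^ m * (fallingMoment p m / (m ! : ℝ))) := fun m => by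
    rw [integral_const_mul, integral_pow_mul_exp_neg_mul m hu, hA, div_pow]
    have : (m ! : ℝ) ≠ 0 := by positivity
    field_simp
    ring
  have hintegrable : ∀ m, Integrable (fun t => A m * (t ^ m * Real.exp (-(u * t))))
      (volume.restrict (Ioi 0)) := fun m => by
    refine Integrable.const_mul (Integrable.of_integral_ne_zero ?_) _
    rw [integral_pow_mul_exp_neg_mul m hu]
    positivity
  have hnorm : ∀ m, ∫ t in Ioi 0, ‖A m * (t ^ m * Real.exp (-(u * t)))‖ =
      ∫ t in Ioi 0, A m * (t ^ m * Real.exp (-(u * t))) := fun m =>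
    setIntegral_congr_fun measurableSet_Ioi fun t ht => by
      have : (0 : ℝ) < t := ht
      have := hA0 m
      exact Real.norm_of_nonneg (by positivity)
  have h := hasSum_integral_of_summable_integral_norm hintegrable (by
    simp only [hnorm, hint]
    exact hsum.mul_left _)
  simp only [hint] at h
  have hval : ∫ t in Ioi 0, Real.exp (-(s * t)) * invLaplace c p t =
      1 / u * ordGenFun p (c / u) := by
    rw [ordGenFun, ← tsum_mul_left, h.tsum_eq]
    congr 1 with t
    rw [invLaplace, expGenFun, ← mul_assoc, ← Real.exp_add, ← tsum_mul_left]
    refine tsum_congr fun m => ?_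
    rw [hA, show -(s * t) + c * t = -(u * t) by rw [hu_def]; ring]
    ring
  refine ⟨Integrable.of_integral_ne_zero ?_, hval⟩
  -- the transform is positive because of the term `m = 0`
  rw [hval]
  have h1 : 1 ≤ ordGenFun p (c / u) := by
    have h2 := hsum.le_tsum 0 fun j _ => by
      have := fallingMoment_nonneg hp j
      positivity
    simpa [ordGenFun, fallingMoment_zero hp] using h2
  positivity

lemma isInverseLaplace_invLaplace (hp : IsMassFun p) (hc : 0 ≤ c) (hne : (ordDomain c p).Nonempty) :
    IsInverseLaplace (ordDomain c p) (fun s => 1 / (s - c) * ordGenFun p (c / (s - c)))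
      (invLaplace c p) := by
  obtain ⟨s, hs⟩ := hne
  exact ⟨(continuous_invLaplace hp hc hs).continuousOn, fun s hs => hasLaplace_invLaplace hp hc hs⟩

lemma IsInverseLaplace.eqOn_invLaplace (hp : IsMassFun p) (hc : 0 ≤ c)
    (hne : (ordDomain c p).Nonempty) {M : ℝ → ℝ}
    (hM : IsInverseLaplace (ordDomain c p)
      (fun s => 1 / (s - c) * ordGenFun p (c / (s - c))) M) :
    EqOn M (invLaplace c p) (Ioi 0) := by
  obtain ⟨s, hs⟩ := hne
  exact eqOn_of_hasLaplace (hM.1.mono Ioi_subset_Ici_self)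
    (continuous_invLaplace hp hc hs).continuousOn
    (fun s' hs' => hM.2 s' (mem_ordDomain_of_le hp hc hs hs'))
    (fun s' hs' => hasLaplace_invLaplace hp hc (mem_ordDomain_of_le hp hc hs hs'))

section Output
variable {η : ℝ} (hη : η ∈ Icc (0 : ℝ) 1) {q : ℕ → ℝ}

lemma add_mem_ordDomain (hp : IsMassFun p) (hq : IsMassFun q) {s s' : ℝ}
    (hs : s ∈ ordDomain η p) (hs' : s' ∈ ordDomain (1 - η) q) :
    s + s' ∈ ordDomain 1 (outputMassFun hη p q) := by
  obtain ⟨h1, hpm, hps⟩ := hs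
  obtain ⟨h2, hqm, hqs⟩ := hs'
  refine ⟨by linarith, finiteMoments_outputMassFun hη hp hq hpm hqm, ?_⟩
  set u := s - η with hu_def
  set v := s' - (1 - η) with hv_def
  have hu : 0 < u := by linarith
  have hv : 0 < v := by linarith
  have huv : s + s' - 1 = u + v := by rw [hu_def, hv_def]; ring
  have hη' : 0 ≤ 1 - η := by linarith [hη.2]
  have hη0 : 0 ≤ η := hη.1
  have hfac : ∀ (r : ℕ → ℝ) m, fallingMoment r m / (m ! : ℝ) = m ! * expGenCoeff r m := by
    intro r m
    rw [expGenCoeff]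
    field_simp
  have hnn : ∀ {r : ℕ → ℝ}, IsMassFun r → ∀ m, 0 ≤ expGenCoeff r m := fun hr m => by
    have := fallingMoment_nonneg hr m
    unfold expGenCoeff
    positivity
  simp only [huv, hfac] at hps hqs ⊢
  have hsum := (summable_norm_sum_mul_antidiagonal_of_summable_norm hps.norm hqs.norm).of_norm
  refine Summable.of_nonneg_of_le (fun m => ?_) (fun m => ?_) hsum
  · have := hnn (isMassFun_outputMassFun hη hp hq) m
    positivity
  rw [expGenCoeff_outputMassFun hη hp hq hpm hqm, Finset.mul_sum, Finset.mul_sum]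
  refine Finset.sum_le_sum fun l hl => ?_
  have hl' := Finset.HasAntidiagonal.mem_antidiagonal.mp hl
  have hA := hnn hp l.1
  have hB := hnn hq l.2
  -- one term of the binomial expansion of `(u + v) ^ m`
  have hbin : ((m.choose l.1 : ℝ) * (u ^ l.1 * v ^ l.2)) ≤ (u + v) ^ m := by
    rw [(Commute.all u v).add_pow' m]
    simp only [nsmul_eq_mul]
    exact Finset.single_le_sum (f := fun k : ℕ × ℕ => (m.choose k.1 : ℝ) * (u ^ k.1 * v ^ k.2))
      (fun k _ => by positivity) hl
  have hch : (m ! : ℝ) = m.choose l.1 * l.1 ! * l.2 ! := by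
    have h3 := Nat.choose_mul_factorial_mul_factorial (show l.1 ≤ m by omega)
    rw [show m - l.1 = l.2 by omega] at h3
    exact_mod_cast h3.symm
  have hle : (1 / (u + v)) ^ m * m.choose l.1 ≤ (1 / u) ^ l.1 * (1 / v) ^ l.2 := by
    rw [one_div_pow, one_div_pow, one_div_pow, one_div_mul_one_div, one_div_mul_eq_div,
      div_le_div_iff₀ (by positivity) (by positivity)]
    linarith
  calc _ = ((1 / (u + v)) ^ m * m.choose l.1) * ((η ^ l.1 * (l.1 ! * expGenCoeff p l.1)) *
        ((1 - η) ^ l.2 * (l.2 ! * expGenCoeff q l.2))) := by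
        rw [hch]
        ring
    _ ≤ ((1 / u) ^ l.1 * (1 / v) ^ l.2) * ((η ^ l.1 * (l.1 ! * expGenCoeff p l.1)) *
        ((1 - η) ^ l.2 * (l.2 ! * expGenCoeff q l.2))) := by gcongr
    _ = _ := by
        rw [div_eq_mul_one_div η u, div_eq_mul_one_div (1 - η) v, mul_pow, mul_pow]
        ring

/-- The inverse Laplace transforms multiply because the exponential generating functions do. -/
lemma invLaplace_mul_invLaplace (hp : IsMassFun p) (hq : IsMassFun q)
    (hpne : (ordDomain η p).Nonempty) (hqne : (ordDomain (1 - η) q).Nonempty) (t : ℝ) :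
    invLaplace η p t * invLaplace (1 - η) q t = invLaplace 1 (outputMassFun hη p q) t := by
  obtain ⟨s, hs⟩ := hpne
  obtain ⟨s', hs'⟩ := hqne
  have h := (expGen_outputMassFun hη hp hq (expGenConverges_of_mem_ordDomain hp hη.1 hs t)
    (expGenConverges_of_mem_ordDomain hq (by linarith [hη.2]) hs' t)).2
  rw [invLaplace, invLaplace, invLaplace, one_mul, h, mul_mul_mul_comm, ← Real.exp_add]
  ring_nf

end Output

lemma HasLaplace.congr {f g : ℝ → ℝ} {s v : ℝ} (h : HasLaplace f s v) (hfg : EqOn f g (Ioi 0)) :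
    HasLaplace g s v := by
  have h1 : EqOn (fun t => Real.exp (-(s * t)) * f t) (fun t => Real.exp (-(s * t)) * g t)
      (Ioi 0) := fun t ht => by simp only [hfg ht]
  exact ⟨h.1.congr_fun h1 measurableSet_Ioi,
    (setIntegral_congr_fun measurableSet_Ioi h1).symm.trans h.2⟩

lemma isMassFun_massFun {Ω : Type*} [MeasurableSpace Ω] (μ : Measure Ω) [IsProbabilityMeasure μ]
    {X : Ω → ℕ} (hX : Measurable X) : IsMassFun (massFun μ X) := by
  refine ⟨fun n => measureReal_nonneg, ?_⟩
  have h1 : ∑' n, μ (X ⁻¹' {n}) = 1 := by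
    rw [← measure_iUnion (fun i j hij => Disjoint.preimage X (by simpa using hij))
      (fun n => hX (measurableSet_singleton n)), ← preimage_iUnion, iUnion_of_singleton]
    simp
  have h2 := ENNReal.summable_toReal (f := fun n => μ (X ⁻¹' {n})) (by rw [h1]; simp)
  have h3 := h2.hasSum
  rwa [← ENNReal.tsum_toReal_eq fun n => measure_ne_top _ _, h1] at h3

end Beamsplitter

theorem theorem2 {Ω : Type*} [MeasurableSpace Ω] (μ : Measure Ω) [IsProbabilityMeasure μ]
    (X Y : Ω → ℕ) (hX : Measurable X) (hY : Measurable Y) (hXY : IndepFun X Y μ)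
    (η : ℝ) (hη : η ∈ Icc (0 : ℝ) 1) (pX pY pZ : ℕ → ℝ)
    (hpX : pX = massFun μ X) (hpY : pY = massFun μ Y) (hpZ : pZ = beamsplitterAdd η pX pY) :
    -- the beamsplitter sum is a random variable on the non-negative integers
    IsMassFun pZ ∧
    -- 1, as an identity of formal power series
    (FiniteMoments pX → FiniteMoments pY →
      FiniteMoments pZ ∧
        expGenSeries pZ =
          PowerSeries.rescale η (expGenSeries pX) *
            PowerSeries.rescale (1 - η) (expGenSeries pY)) ∧
    -- 1, pointwise, wherever the series on the right converge
    (∀ t : ℝ, ExpGenConverges pX (η * t) → ExpGenConverges pY ((1 - η) * t) →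
      ExpGenConverges pZ t ∧
        expGenFun pZ t = expGenFun pX (η * t) * expGenFun pY ((1 - η) * t)) ∧
    -- 1, on the half-line `t ≤ 0` and without moments, in the Laguerre form
    (∀ t : ℝ, t ≤ 0 →
      Summable (fun n => pX n * laguerre n (-(η * t))) ∧
      Summable (fun n => pY n * laguerre n (-((1 - η) * t))) ∧
      HasSum (fun n => pZ n * laguerre n (-t))
        ((∑' n, pX n * laguerre n (-(η * t))) * ∑' n, pY n * laguerre n (-((1 - η) * t)))) ∧
    -- 2
    ((ordDomain η pX).Nonempty → (ordDomain (1 - η) pY).Nonempty →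
      (∃ MX, IsInverseLaplace (ordDomain η pX)
        (fun s => 1 / (s - η) * ordGenFun pX (η / (s - η))) MX) ∧
      (∃ MY, IsInverseLaplace (ordDomain (1 - η) pY)
        (fun s => 1 / (s - (1 - η)) * ordGenFun pY ((1 - η) / (s - (1 - η)))) MY) ∧
      (∀ sX ∈ ordDomain η pX, ∀ sY ∈ ordDomain (1 - η) pY, sX + sY ∈ ordDomain 1 pZ) ∧
      ∀ MX MY : ℝ → ℝ,
        IsInverseLaplace (ordDomain η pX)
          (fun s => 1 / (s - η) * ordGenFun pX (η / (s - η))) MX →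
        IsInverseLaplace (ordDomain (1 - η) pY)
          (fun s => 1 / (s - (1 - η)) * ordGenFun pY ((1 - η) / (s - (1 - η)))) MY →
        ∀ s ∈ ordDomain 1 pZ,
          HasLaplace (fun t => MX t * MY t) s (1 / (s - 1) * ordGenFun pZ (1 / (s - 1)))) := by
  have hp : IsMassFun pX := hpX ▸ isMassFun_massFun μ hX
  have hq : IsMassFun pY := hpY ▸ isMassFun_massFun μ hY
  have hη' : 0 ≤ 1 - η := by linarith [hη.2]
  have hZ : pZ = outputMassFun hη pX pY := hpZ.trans (beamsplitterAdd_eq hη hp hq)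
  have hr : IsMassFun pZ := hZ ▸ isMassFun_outputMassFun hη hp hq
  refine ⟨hr, fun hpm hqm => ?_, fun t hpt hqt => ?_, fun t ht => ?_, fun hpne hqne =>
    ⟨⟨_, isInverseLaplace_invLaplace hp hη.1 hpne⟩, ⟨_, isInverseLaplace_invLaplace hq hη' hqne⟩,
      fun s hs s' hs' => ?_, fun MX MY hMX hMY s hs => ?_⟩⟩
  · rw [hZ]
    exact ⟨finiteMoments_outputMassFun hη hp hq hpm hqm,
      expGenSeries_outputMassFun hη hp hq hpm hqm⟩
  · rw [hZ]
    exact expGen_outputMassFun hη hp hq hpt hqt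
  · have ht' : 0 ≤ -t := neg_nonneg.mpr ht
    rw [hZ, ← mul_neg, ← mul_neg]
    exact ⟨hp.summable_mul_laguerre (mul_nonneg hη.1 ht'),
      hq.summable_mul_laguerre (mul_nonneg hη' ht'),
      hasSum_outputMassFun_mul_laguerre hη hp hq ht'⟩
  · rw [hZ]
    exact add_mem_ordDomain hη hp hq hs hs'
  · refine (hasLaplace_invLaplace hr zero_le_one hs).congr fun t ht => ?_
    rw [hZ, ← invLaplace_mul_invLaplace hη hp hq hpne hqne,
      hMX.eqOn_invLaplace hp hη.1 hpne ht, hMY.eqOn_invLaplace hq hη' hqne ht]
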